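/- Let $V_0:\mathbb R\to\mathbb R$ be a $C^\infty$, $2\pi$-periodic function with zero average, and let $\lambda_1<\lambda_2<\cdots$ be the eigenvalues of $-\partial_{xx}+V_0$ on $[0,\pi]$ with Dirichlet boundary conditions. Put $m_0:=-\min_j\lambda_j$ and, for $m>m_0$, let $\omega_j:=\sqrt{\lambda_j+m}$, $j\ge1$ (the frequencies of the linear part of the nonlinear wave equation $u_{tt}-u_{xx}+(V_0(x)+m)u=g(x,u)$ with Dirichlet boundary conditions). Then for every $\Delta>m_0$ there is a measurable set $\mathcal I\subset(m_0,\Delta)$ of Lebesgue measure $\Delta-m_0$ such that for every $m\in\mathcal I$ and every integer $r\ge1$ the following nonresonance condition ($r$-NR) holds: there exist $\gamma>0$ and $\alpha\in\mathbb R$ such that for all sufficiently large integers $N$ $$\Bigl|\sum_{j\ge1}\omega_jk_j\Bigr|\ \ge\ \frac{\gamma}{N^{\alpha}}$$ for every integer sequence $k=(k_j)_{j\ge1}$ with $0\ne|k|:=\sum_j|k_j|\le r+2$ and $\sum_{j>N}|k_j|\le2$. -/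

import Mathlib

open MeasureTheory Filter

noncomputable section

namespace DirichletNLW

/-- `μ` is an eigenvalue of `-∂ₓₓ + V` on `[0, π]` with Dirichlet boundary conditions: there is a
`C²` eigenfunction that vanishes at `0` and `π` but not identically on `[0, π]`. -/
def IsDirichletEigenvalue (V : ℝ → ℝ) (μ : ℝ) : Prop :=
  ∃ φ : ℝ → ℝ, ContDiff ℝ 2 φ ∧ φ 0 = 0 ∧ φ Real.pi = 0 ∧
    (∃ x ∈ Set.Icc 0 Real.pi, φ x ≠ 0) ∧
    ∀ x ∈ Set.Icc 0 Real.pi, -deriv (deriv φ) x + V x * φ x = μ * φ x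

/-- The `j`-th Dirichlet eigenvalue of `-∂ₓₓ + V`, `j = 1, 2, …`, in increasing order: the least
`x` such that at least `j` eigenvalues are `≤ x`. (Dirichlet eigenvalues are simple, so counting
the distinct ones is the same as counting with multiplicity.) -/
def eigenvalue (V : ℝ → ℝ) (j : ℕ+) : ℝ :=
  sInf {x : ℝ | ((j : ℕ) : ℕ∞) ≤ {μ : ℝ | IsDirichletEigenvalue V μ ∧ μ ≤ x}.encard}

/-- The threshold `m₀ = -min_j λ_j`, above which all `λ_j + m` are positive. -/
def threshold (V : ℝ → ℝ) : ℝ := -⨅ j : ℕ+, eigenvalue V j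

/-- The frequencies `ω_j = √(λ_j + m)`. -/
def frequency (V : ℝ → ℝ) (m : ℝ) (j : ℕ+) : ℝ := Real.sqrt (eigenvalue V j + m)

/-- The nonresonance condition (`r`-NR) for a frequency vector `ω = (ω_j)_{j ≥ 1}`. An integer
vector `k` with `∑ |k_j| < ∞` is the same as a finitely supported one. -/
def NonResonant (r : ℕ) (ω : ℕ+ → ℝ) : Prop :=
  ∃ γ : ℝ, 0 < γ ∧ ∃ α : ℝ, ∀ᶠ N : ℕ in atTop, ∀ k : ℕ+ →₀ ℤ,
    k ≠ 0 →
    ∑ j ∈ k.support, |k j| ≤ (r : ℤ) + 2 →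
    ∑ j ∈ k.support.filter (fun j : ℕ+ => N < (j : ℕ)), |k j| ≤ 2 →
    γ / (N : ℝ) ^ α ≤ |∑ j ∈ k.support, ω j * (k j : ℝ)|

end DirichletNLW

end

/-! Three facts combine: asymptotics of the spectrum, a measure estimate in `m`, and elimination of
the at most two high modes.

In polar form `y = ρ sin θ`, `y' = ρ cos θ`, the number `μ` is an eigenvalue exactly when the Prüfer
angle at `π` is a multiple of `π`. That end value is positive, continuous and strictly increasing in
`μ`. Comparison with the constant potentials `j²` puts `λ_j` within `sup |V|` of `j²`
(`exists_spectrum`), so `ω_j = j + O(1/j)` and the `λ_j` are uniformly separated.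

Fix `k` supported in `[1, N]` and an integer `n`. Differentiating `∑ ω_j k_j + n` in `m` removes
`n`; dividing by one power and differentiating again removes one term at a time, until a single
nonvanishing power is left. By the mean value theorem the original function cannot be small at many
separated points, so its sublevel sets are small, with only polynomial losses in `N`
(`volume_sublevel_le`). There are polynomially many relevant pairs `(k, n)`, so Borel–Cantelli gives
the bound for almost every `m` (`ae_small_divisor_bound`).

High modes are handled in `nonResonant_of_small_divisor_bound`: if all lie below `2 N ^ p`, the
bound is used at that scale; if all exceed `N ^ p`, they are replaced by integers and absorbed in
`n`; otherwise one of them dominates everything else. -/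

namespace DirichletNLW

open Set Real

/-! ### Prüfer angles -/

/-- `θ` is the Prüfer angle on `[0, π]` of the solution of `y'' = -q y`, `y 0 = 0`, `y' 0 = 1`. -/
structure IsPruferAngle (q θ : ℝ → ℝ) : Prop where
  continuous : Continuous θ
  zero : θ 0 = 0
  hasDerivAt : ∀ t ∈ Icc 0 π, HasDerivAt θ (cos (θ t) ^ 2 + q t * sin (θ t) ^ 2) t

lemma sin_eq_mul_sinc (x : ℝ) : sin x = x * sinc x := by
  by_cases h : x = 0
  · simp [h]
  · rw [sinc_of_ne_zero h]; field_simp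

/-- The factor `sinc` makes the difference of two Prüfer equations linear in the difference of the
angles, with a continuous coefficient. -/
lemma sin_sq_sub_sin_sq (x y : ℝ) :
    sin x ^ 2 - sin y ^ 2 = (x - y) * (sinc (x - y) * sin (x + y)) := by
  rw [← mul_assoc, ← sin_eq_mul_sinc, sin_add, sin_sub]
  linear_combination (-sin x ^ 2) * sin_sq_add_cos_sq y + sin y ^ 2 * sin_sq_add_cos_sq x

/-- Linear differential inequality: a solution of `d' = a d + b`, `d 0 = 0`, with `b ≥ 0` stays
nonnegative, and vanishes at the end only if `b` vanishes. -/
lemma linear_ode_nonneg {a b d : ℝ → ℝ} {T : ℝ} (hT : 0 < T) (ha : Continuous a) (hd0 : d 0 = 0)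
    (hd : ∀ t ∈ Icc 0 T, HasDerivAt d (a t * d t + b t) t) (hb : ∀ t ∈ Icc 0 T, 0 ≤ b t) :
    0 ≤ d T ∧ (d T = 0 → ∀ t ∈ Ioo 0 T, d t = 0 ∧ b t = 0) := by
  set A : ℝ → ℝ := fun t => ∫ s in (0 : ℝ)..t, a s
  have hA : ∀ t, HasDerivAt A (a t) t := fun t => (ha.integral_hasStrictDerivAt 0 t).hasDerivAt
  -- Integrating factor: `w' = b exp (-A) ≥ 0`, so `w` is monotone, and constant if its end values
  -- agree.
  set w : ℝ → ℝ := fun t => d t * exp (-A t)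
  have hw : ∀ t ∈ Icc 0 T, HasDerivAt w (b t * exp (-A t)) t := by
    intro t ht
    convert! (hd t ht).mul (hA t).neg.exp using 1
    simp only [Pi.neg_apply]
    ring
  have hmono : MonotoneOn w (Icc 0 T) := by
    refine monotoneOn_of_hasDerivWithinAt_nonneg (convex_Icc 0 T)
      (fun t ht => (hw t ht).continuousAt.continuousWithinAt)
      (fun t ht => (hw t (interior_subset ht)).hasDerivWithinAt) ?_
    exact fun t ht => mul_nonneg (hb t (interior_subset ht)) (exp_pos _).le
  have hw0 : w 0 = 0 := by simp [w, hd0]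
  have h0 : (0 : ℝ) ∈ Icc 0 T := left_mem_Icc.2 hT.le
  have h1 : T ∈ Icc 0 T := right_mem_Icc.2 hT.le
  constructor
  · have : 0 ≤ w T := hw0 ▸ hmono h0 h1 hT.le
    exact nonneg_of_mul_nonneg_left this (exp_pos _)
  · intro hdT
    have hwT : w T = 0 := by simp [w, hdT]
    have hwz : ∀ t ∈ Icc 0 T, w t = 0 := fun t ht =>
      le_antisymm (hwT ▸ hmono ht h1 ht.2) (hw0 ▸ hmono h0 ht ht.1)
    intro t ht
    have ht' := Ioo_subset_Icc_self ht
    refine ⟨by simpa [w, (exp_pos _).ne'] using hwz t ht', ?_⟩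
    have he : w =ᶠ[nhds t] fun _ => 0 := by
      filter_upwards [Ioo_mem_nhds ht.1 ht.2] with s hs using hwz s (Ioo_subset_Icc_self hs)
    have := (hw t ht').unique ((hasDerivAt_const t (0 : ℝ)).congr_of_eventuallyEq he)
    simpa [(exp_pos _).ne'] using this

lemma exists_isPruferAngle {q : ℝ → ℝ} (hq : Continuous q) : ∃ θ, IsPruferAngle q θ := by
  obtain ⟨Q, hQ⟩ := isCompact_Icc.exists_bound_of_continuousOn (s := Icc 0 π) hq.continuousOn
  have hQ0 : 0 ≤ Q := (norm_nonneg _).trans (hQ 0 (left_mem_Icc.2 pi_pos.le))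
  set F : ℝ → ℝ → ℝ := fun t x => cos x ^ 2 + q t * sin x ^ 2
  have hF : ∀ t x, F t x = 1 + (q t - 1) * sin x ^ 2 := fun t x => by
    simp only [F]; rw [cos_sq']; ring
  -- The field is bounded uniformly in `x`, so a solution starting at `0` stays in the ball of
  -- radius `(2 + Q) π` up to time `π`.
  have hpl : IsPicardLindelof F (⟨0, left_mem_Icc.2 pi_pos.le⟩ : Icc 0 π) (0 : ℝ)
      (Real.toNNReal ((2 + Q) * π)) 0 (Real.toNNReal (2 + Q)) (Real.toNNReal (2 * (Q + 1))) := by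
    refine ⟨fun t ht => ?_, fun x _ => by fun_prop, fun t ht x _ => ?_, ?_⟩
    · refine LipschitzOnWith.of_dist_le_mul fun x _ y _ => ?_
      rw [Real.coe_toNNReal _ (by positivity), Real.dist_eq, Real.dist_eq, hF, hF]
      have h1 : 1 + (q t - 1) * sin x ^ 2 - (1 + (q t - 1) * sin y ^ 2)
          = (q t - 1) * ((sin x + sin y) * (sin x - sin y)) := by ring
      have h2 := hQ t ht
      rw [Real.norm_eq_abs] at h2
      have h3 : |q t - 1| ≤ Q + 1 := (abs_sub _ _).trans (by simpa using h2)
      have h4 : |sin x + sin y| ≤ 2 := (abs_add_le _ _).trans (by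
        linarith [abs_sin_le_one x, abs_sin_le_one y])
      have h5 : |sin x - sin y| ≤ |x - y| := abs_sin_sub_sin_le x y
      rw [h1, abs_mul, abs_mul]
      calc |q t - 1| * (|sin x + sin y| * |sin x - sin y|) ≤ (Q + 1) * (2 * |x - y|) := by gcongr
        _ = _ := by ring
    · rw [Real.coe_toNNReal _ (by positivity), Real.norm_eq_abs]
      have h2 := hQ t ht
      rw [Real.norm_eq_abs] at h2
      refine (abs_add_le _ _).trans ?_
      rw [abs_mul, abs_of_nonneg (sq_nonneg (cos x)), abs_of_nonneg (sq_nonneg (sin x))]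
      nlinarith [cos_sq_le_one x, sin_sq_le_one x, sq_nonneg (sin x), abs_nonneg (q t)]
    · rw [Real.coe_toNNReal _ (by positivity), Real.coe_toNNReal _ (by positivity)]
      simp [pi_pos.le]
  obtain ⟨α, hα0, hα⟩ := hpl.exists_eq_forall_mem_Icc_hasDerivWithinAt₀
  have hαc : ContinuousOn α (Icc 0 π) := HasDerivWithinAt.continuousOn hα
  -- Picard–Lindelöf gives only one-sided derivatives at `0` and `π`. Integrating the field along a
  -- constant extension of `α` gives a function differentiable on all of `ℝ`.
  set β : ℝ → ℝ := IccExtend pi_pos.le ((Icc 0 π).domRestrict α)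
  have hβc : Continuous β := (continuousOn_iff_continuous_domRestrict.1 hαc).Icc_extend'
  have hβ : ∀ t ∈ Icc 0 π, β t = α t := fun t ht => IccExtend_of_mem _ _ ht
  have hGc : Continuous fun t => F t (β t) := by fun_prop
  set θ : ℝ → ℝ := fun t => ∫ s in (0 : ℝ)..t, F s (β s)
  have hθ : ∀ t, HasDerivAt θ (F t (β t)) t :=
    fun t => (hGc.integral_hasStrictDerivAt 0 t).hasDerivAt
  have hθc : Continuous θ := continuous_iff_continuousAt.2 fun t => (hθ t).continuousAt
  have heq : ∀ t ∈ Icc 0 π, θ t = α t := by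
    refine eq_of_has_deriv_right_eq (f' := fun t => F t (β t))
      (fun t _ => (hθ t).hasDerivWithinAt) (fun t ht => ?_) hθc.continuousOn hαc ?_
    · have ht' := Ico_subset_Icc_self ht
      rw [hβ t ht']
      exact ((hα t ht').mono_of_mem_nhdsWithin (Icc_mem_nhdsGE_of_mem ht))
    · simpa [θ] using hα0.symm
  refine ⟨θ, hθc, by simp [θ], fun t ht => ?_⟩
  have := hθ t
  rwa [hβ t ht, ← heq t ht] at this

namespace IsPruferAngle

variable {q q₁ q₂ θ θ₁ θ₂ : ℝ → ℝ}

lemma pos (h : IsPruferAngle q θ) (hq : Continuous q) : 0 < θ π := by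
  have hθ := h.continuous
  obtain ⟨h1, h2⟩ := linear_ode_nonneg (a := fun t => (q t - 1) * (sinc (θ t) * sin (θ t)))
    (b := fun _ => 1) (d := θ) pi_pos (by have := continuous_sinc; fun_prop) h.zero
    (fun t ht => by
      convert h.hasDerivAt t ht using 1
      have := sin_eq_mul_sinc (θ t)
      rw [cos_sq']
      linear_combination (1 - q t) * sin (θ t) * this) (fun _ _ => zero_le_one)
  refine lt_of_le_of_ne h1 fun h3 => ?_
  exact one_ne_zero (h2 h3.symm (π / 2) ⟨by positivity, by linarith [pi_pos]⟩).2

lemma hasDerivAt_sub (h₁ : IsPruferAngle q₁ θ₁) (h₂ : IsPruferAngle q₂ θ₂) {t : ℝ}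
    (ht : t ∈ Icc 0 π) : HasDerivAt (fun t => θ₂ t - θ₁ t)
      ((q₁ t - 1) * (sinc (θ₂ t - θ₁ t) * sin (θ₂ t + θ₁ t)) * (θ₂ t - θ₁ t) +
        (q₂ t - q₁ t) * sin (θ₂ t) ^ 2) t := by
  convert! (h₂.hasDerivAt t ht).sub (h₁.hasDerivAt t ht) using 1
  have := sin_sq_sub_sin_sq (θ₂ t) (θ₁ t)
  rw [cos_sq', cos_sq']
  linear_combination (1 - q₁ t) * this

lemma le_of_le (h₁ : IsPruferAngle q₁ θ₁) (h₂ : IsPruferAngle q₂ θ₂) (hq₁ : Continuous q₁)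
    (hle : ∀ t ∈ Icc 0 π, q₁ t ≤ q₂ t) : θ₁ π ≤ θ₂ π := by
  have := h₁.continuous
  have := h₂.continuous
  have := continuous_sinc
  refine sub_nonneg.1 (linear_ode_nonneg pi_pos ?_ (by simp [h₁.zero, h₂.zero])
    (fun t ht => h₁.hasDerivAt_sub h₂ ht)
    (fun t ht => mul_nonneg (sub_nonneg.2 (hle t ht)) (sq_nonneg _))).1
  fun_prop

lemma lt_of_lt (h₁ : IsPruferAngle q₁ θ₁) (h₂ : IsPruferAngle q₂ θ₂) (hq₁ : Continuous q₁)
    (hlt : ∀ t ∈ Icc 0 π, q₁ t < q₂ t) : θ₁ π < θ₂ π := by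
  have := h₁.continuous
  have := h₂.continuous
  have := continuous_sinc
  obtain ⟨h3, h4⟩ := linear_ode_nonneg pi_pos (by fun_prop) (by simp [h₁.zero, h₂.zero])
    (fun t ht => h₁.hasDerivAt_sub h₂ ht)
    (fun t ht => mul_nonneg (sub_nonneg.2 (hlt t ht).le) (sq_nonneg _))
  refine sub_pos.1 (lt_of_le_of_ne h3 fun h5 => ?_)
  -- Equal end values would force `sin θ₂` to vanish on an interval, but at a zero of `sin θ₂` the
  -- Prüfer equation gives `θ₂' = cos² θ₂ = 1`.
  have h6 : ∀ t ∈ Ioo 0 π, sin (θ₂ t) = 0 := fun t ht => by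
    have := (h4 h5.symm t ht).2
    have h7 := hlt t (Ioo_subset_Icc_self ht)
    simpa [sub_eq_zero, h7.ne'] using this
  have hm : π / 2 ∈ Ioo 0 π := ⟨by positivity, by linarith [pi_pos]⟩
  have he : (fun t => sin (θ₂ t)) =ᶠ[nhds (π / 2)] fun _ => 0 := by
    filter_upwards [Ioo_mem_nhds hm.1 hm.2] with s hs using h6 s hs
  have := (h₂.hasDerivAt _ (Ioo_subset_Icc_self hm)).sin.unique
    ((hasDerivAt_const _ (0 : ℝ)).congr_of_eventuallyEq he)
  have h8 := sin_sq_add_cos_sq (θ₂ (π / 2))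
  rw [h6 _ hm] at this h8
  have h9 : cos (θ₂ (π / 2)) ^ 2 = 1 := by simpa using h8
  rw [h9] at this
  have h10 : cos (θ₂ (π / 2)) = 0 := by simpa using this
  simp [h10] at h9

end IsPruferAngle

/-- The solution is `sin (n t) / n`, so `tan θ = tan (n t) / n`. The subtraction formula for `tan (θ
- n t)` gives the argument of `arctan`; its denominator never vanishes, so the branch is continuous.
For integer `n` the correction is zero at `π`. -/
lemma isPruferAngle_const {n : ℝ} (hn : 0 < n) :
    IsPruferAngle (fun _ => n ^ 2) fun t => n * t + arctan
      ((1 - n) * (sin (n * t) * cos (n * t)) / (n * cos (n * t) ^ 2 + sin (n * t) ^ 2)) := by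
  have hD : ∀ t, 0 < n * cos (n * t) ^ 2 + sin (n * t) ^ 2 := fun t => by
    rcases eq_or_ne (sin (n * t)) 0 with h | h
    · have : cos (n * t) ^ 2 = 1 := by rw [cos_sq', h]; ring
      rw [this, h]; linarith
    · positivity
  have hder : ∀ t, HasDerivAt (fun t => n * t + arctan
      ((1 - n) * (sin (n * t) * cos (n * t)) / (n * cos (n * t) ^ 2 + sin (n * t) ^ 2)))
      (cos (n * t + arctan
      ((1 - n) * (sin (n * t) * cos (n * t)) / (n * cos (n * t) ^ 2 + sin (n * t) ^ 2))) ^ 2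
      + n ^ 2 * sin (n * t + arctan
      ((1 - n) * (sin (n * t) * cos (n * t)) / (n * cos (n * t) ^ 2 + sin (n * t) ^ 2))) ^ 2) t := by
    intro t
    have hl : HasDerivAt (fun t => n * t) n t := by simpa using (hasDerivAt_id t).const_mul n
    have hs := hl.sin
    have hc := hl.cos
    have hu := ((hs.fun_mul hc).const_mul (1 - n)).fun_div
      (((hc.fun_pow 2).const_mul n).fun_add (hs.fun_pow 2)) (hD t).ne'
    have := hl.fun_add hu.arctan
    refine this.congr_deriv ?_
    have hDt := (hD t).ne'
    rw [cos_add, sin_add, cos_arctan, sin_arctan]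
    set s := sin (n * t)
    set c := cos (n * t)
    set D := n * c ^ 2 + s ^ 2 with hDdef
    set u := (1 - n) * (s * c) / D with hu
    have hsc : s ^ 2 + c ^ 2 = 1 := sin_sq_add_cos_sq _
    have h1 : c - s * u = n * c / D := by
      rw [hu]; field_simp; rw [hDdef]; linear_combination n * c * hsc
    have h2 : s + c * u = s / D := by
      rw [hu]; field_simp; rw [hDdef]; linear_combination s * hsc
    have hg : 0 < 1 + u ^ 2 := by positivity
    have hsq : √(1 + u ^ 2) ^ 2 = 1 + u ^ 2 := sq_sqrt hg.le
    have e1 : (c * (1 / √(1 + u ^ 2)) - s * (u / √(1 + u ^ 2))) ^ 2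
        = (c - s * u) ^ 2 / (1 + u ^ 2) := by
      rw [← hsq, ← div_pow, hsq]; ring
    have e2 : (s * (1 / √(1 + u ^ 2)) + c * (u / √(1 + u ^ 2))) ^ 2
        = (s + c * u) ^ 2 / (1 + u ^ 2) := by
      rw [← hsq, ← div_pow, hsq]; ring
    rw [e1, e2, h1, h2]
    have h3 : 1 + u ^ 2 = (n ^ 2 * c ^ 2 + s ^ 2) / D ^ 2 := by
      rw [hu]; field_simp; rw [hDdef]
      linear_combination (n ^ 2 * c ^ 2 + s ^ 2) * hsc
    have h4 : n ^ 2 * c ^ 2 + s ^ 2 ≠ 0 := by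
      intro h; rw [h, zero_div] at h3; exact hg.ne' h3
    have h5 : n * (n ^ 2 * c ^ 2 + s ^ 2) + ((1 - n) * (c * n * c + s * (-s * n)) * D -
        (1 - n) * (s * c) * (n * ((2 : ℕ) * c ^ (2 - 1) * (-s * n)) +
          (2 : ℕ) * s ^ (2 - 1) * (c * n))) = n ^ 2 := by
      rw [hDdef]
      push_cast
      simp only [pow_one]
      linear_combination (n * (1 - n) * (n * c ^ 2 - s ^ 2) + n ^ 2) * hsc
    have h6 : (n * c / D) ^ 2 / ((n ^ 2 * c ^ 2 + s ^ 2) / D ^ 2) +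
        n ^ 2 * ((s / D) ^ 2 / ((n ^ 2 * c ^ 2 + s ^ 2) / D ^ 2)) =
        n ^ 2 / (n ^ 2 * c ^ 2 + s ^ 2) := by
      field_simp
      linear_combination hsc
    rw [h3, h6, eq_div_iff h4]
    refine Eq.trans ?_ h5
    field_simp
  exact ⟨continuous_iff_continuousAt.2 fun t => (hder t).continuousAt, by simp,
    fun t _ => hder t⟩

lemma IsPruferAngle.const_apply_pi {n : ℕ} {θ : ℝ → ℝ} (hn : 0 < n)
    (h : IsPruferAngle (fun _ => (n : ℝ) ^ 2) θ) : θ π = n * π := by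
  have h' := isPruferAngle_const (n := n) (by exact_mod_cast hn)
  have h1 := h.le_of_le h' continuous_const fun _ _ => le_rfl
  have h2 := h'.le_of_le h continuous_const fun _ _ => le_rfl
  have h3 := le_antisymm h1 h2
  simpa [sin_nat_mul_pi] using h3

/-- The end value of the Prüfer angle depends continuously on the spectral parameter. -/
lemma continuous_pruferAngle {V : ℝ → ℝ} (hV : Continuous V) {Θ : ℝ → ℝ → ℝ}
    (hΘ : ∀ μ, IsPruferAngle (fun t => μ - V t) (Θ μ)) : Continuous fun μ => Θ μ π := by
  obtain ⟨C, hC⟩ := isCompact_Icc.exists_bound_of_continuousOn (s := Icc 0 π) hV.continuousOn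
  refine continuous_iff_continuousAt.2 fun μ => ?_
  -- Grönwall for the linear equation of the difference: its coefficient is bounded independently of
  -- `ν`, and its source by `|ν - μ|`.
  have key : ∀ ν, ‖Θ ν π - Θ μ π‖ ≤ gronwallBound 0 (|μ| + C + 1) |ν - μ| π := by
    intro ν
    have := norm_le_gronwallBound_of_norm_deriv_right_le (a := 0) (b := π) (δ := 0)
      (K := |μ| + C + 1) (ε := |ν - μ|)
      (((hΘ ν).continuous.sub (hΘ μ).continuous).continuousOn)
      (fun t ht => ((hΘ μ).hasDerivAt_sub (hΘ ν) (Ico_subset_Icc_self ht)).hasDerivWithinAt)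
      (by simp [(hΘ ν).zero, (hΘ μ).zero]) ?_ π (right_mem_Icc.2 pi_pos.le)
    · simpa using this
    · intro t ht
      have hVt := hC t (Ico_subset_Icc_self ht)
      rw [norm_eq_abs] at hVt
      simp only [norm_eq_abs, Pi.sub_apply]
      refine (abs_add_le _ _).trans (add_le_add ?_ ?_)
      · rw [abs_mul, abs_mul, abs_mul]
        gcongr
        have h1 : |μ - V t - 1| ≤ |μ| + C + 1 := by
          refine (abs_sub _ _).trans ?_
          rw [abs_one]
          linarith [abs_sub μ (V t)]
        have h2 : |sinc (Θ ν t - Θ μ t)| * |sin (Θ ν t + Θ μ t)| ≤ 1 :=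
          mul_le_one₀ (abs_sinc_le_one _) (abs_nonneg _) (abs_sin_le_one _)
        calc _ ≤ (|μ| + C + 1) * 1 := by gcongr; exact (abs_nonneg _).trans h1
          _ = _ := mul_one _
      · rw [abs_mul, abs_of_nonneg (sq_nonneg (sin (Θ ν t)))]
        have : ν - V t - (μ - V t) = ν - μ := by ring
        rw [this]
        exact mul_le_of_le_one_right (abs_nonneg _) (sin_sq_le_one _)
  have hlim : Tendsto (fun ν => gronwallBound 0 (|μ| + C + 1) |ν - μ| π) (nhds μ) (nhds 0) := by
    have h1 : Tendsto (fun ν => |ν - μ|) (nhds μ) (nhds 0) := by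
      have : Continuous fun ν => |ν - μ| := by fun_prop
      simpa using this.tendsto μ
    have h2 := (gronwallBound_continuous_ε 0 (|μ| + C + 1) π).tendsto 0
    rw [gronwallBound_ε0_δ0] at h2
    exact h2.comp h1
  exact tendsto_iff_norm_sub_tendsto_zero.2 (squeeze_zero (fun _ => norm_nonneg _) key hlim)

/-! ### From Prüfer angles to the Dirichlet spectrum -/

/-- A Prüfer angle produces a solution of the second order equation. -/
lemma IsPruferAngle.exists_solution {q θ : ℝ → ℝ} (h : IsPruferAngle q θ) (hq : Continuous q) :
    ∃ y : ℝ → ℝ, ContDiff ℝ 2 y ∧ y 0 = 0 ∧ deriv y 0 = 1 ∧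
      (∀ x ∈ Icc 0 π, deriv (deriv y) x = -(q x * y x)) ∧ (y π = 0 ↔ sin (θ π) = 0) := by
  have hθ := h.continuous
  -- `exp A` is the Prüfer radius: `ρ' / ρ = (1 - q) sin θ cos θ`.
  set A : ℝ → ℝ := fun t => ∫ s in (0 : ℝ)..t, (1 - q s) * (sin (θ s) * cos (θ s))
  have hA : ∀ t, HasDerivAt A ((1 - q t) * (sin (θ t) * cos (θ t))) t := fun t =>
    (Continuous.integral_hasStrictDerivAt (by fun_prop) 0 t).hasDerivAt
  have hAc : Continuous A := continuous_iff_continuousAt.2 fun t => (hA t).continuousAt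
  set y₀ : ℝ → ℝ := fun t => exp (A t) * sin (θ t) with hy₀def
  set z₀ : ℝ → ℝ := fun t => exp (A t) * cos (θ t)
  have hy₀c : Continuous y₀ := by fun_prop
  have hz₀c : Continuous z₀ := by fun_prop
  have hy₀ : ∀ t ∈ Icc 0 π, HasDerivAt y₀ (z₀ t) t := fun t ht => by
    refine ((hA t).exp.fun_mul (h.hasDerivAt t ht).sin).congr_deriv ?_
    simp only [z₀]
    linear_combination exp (A t) * cos (θ t) * sin_sq_add_cos_sq (θ t)
  have hz₀ : ∀ t ∈ Icc 0 π, HasDerivAt z₀ (-(q t * y₀ t)) t := fun t ht => by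
    refine ((hA t).exp.fun_mul (h.hasDerivAt t ht).cos).congr_deriv ?_
    simp only [y₀]
    linear_combination (-exp (A t) * sin (θ t) * q t) * sin_sq_add_cos_sq (θ t)
  -- The equations for `y₀` and `z₀` are known only on `[0, π]`; integrating twice gives a function
  -- that is `C²` on the whole line and agrees with `y₀` there.
  set Z : ℝ → ℝ := fun t => 1 + ∫ s in (0 : ℝ)..t, -(q s * y₀ s)
  have hZ : ∀ t, HasDerivAt Z (-(q t * y₀ t)) t := fun t =>
    (Continuous.integral_hasStrictDerivAt (by fun_prop) 0 t).hasDerivAt.const_add 1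
  have hZc : Continuous Z := continuous_iff_continuousAt.2 fun t => (hZ t).continuousAt
  set y : ℝ → ℝ := fun t => ∫ s in (0 : ℝ)..t, Z s
  have hy : ∀ t, HasDerivAt y (Z t) t := fun t =>
    (Continuous.integral_hasStrictDerivAt hZc 0 t).hasDerivAt
  have hyc : Continuous y := continuous_iff_continuousAt.2 fun t => (hy t).continuousAt
  have hZz : ∀ t ∈ Icc 0 π, Z t = z₀ t :=
    eq_of_has_deriv_right_eq (fun t _ => (hZ t).hasDerivWithinAt)
      (fun t ht => (hz₀ t (Ico_subset_Icc_self ht)).hasDerivWithinAt) hZc.continuousOn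
      hz₀c.continuousOn (by simp [Z, z₀, A, h.zero])
  have hyy : ∀ t ∈ Icc 0 π, y t = y₀ t :=
    eq_of_has_deriv_right_eq (fun t _ => (hy t).hasDerivWithinAt)
      (fun t ht => by
        have ht' := Ico_subset_Icc_self ht
        rw [hZz t ht']
        exact (hy₀ t ht').hasDerivWithinAt) hyc.continuousOn
      hy₀c.continuousOn (by simp [y, y₀, h.zero])
  have hdy : deriv y = Z := funext fun t => (hy t).deriv
  have hdZ : deriv Z = fun t => -(q t * y₀ t) := funext fun t => (hZ t).deriv
  refine ⟨y, ?_, by simp [y], by simp [hdy, Z], fun x hx => ?_, ?_⟩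
  · rw [show (2 : WithTop ℕ∞) = 1 + 1 by norm_num, contDiff_succ_iff_deriv, hdy,
      contDiff_one_iff_deriv, hdZ]
    exact ⟨fun t => (hy t).differentiableAt, by simp, fun t => (hZ t).differentiableAt,
      by fun_prop⟩
  · rw [hdy, hdZ, hyy x hx]
  · rw [hyy π (right_mem_Icc.2 pi_pos.le)]
    simp [y₀, (exp_pos _).ne']

/-- Uniqueness for the Cauchy problem of `y'' = -q y` on `[0, π]`. -/
lemma eq_zero_of_second_order {q f g : ℝ → ℝ} (hq : Continuous q)
    (hf : ∀ t ∈ Icc 0 π, HasDerivAt f (g t) t)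
    (hg : ∀ t ∈ Icc 0 π, HasDerivAt g (-(q t * f t)) t) (hf0 : f 0 = 0) (hg0 : g 0 = 0) :
    ∀ t ∈ Icc 0 π, f t = 0 := by
  obtain ⟨Q, hQ⟩ := isCompact_Icc.exists_bound_of_continuousOn (s := Icc 0 π) hq.continuousOn
  have hp : ∀ t ∈ Icc 0 π, HasDerivAt (fun t => (f t, g t)) (g t, -(q t * f t)) t :=
    fun t ht => (hf t ht).prodMk (hg t ht)
  have := eq_zero_of_abs_deriv_le_mul_abs_self_of_eq_zero_right (K := max 1 Q)
    (fun t ht => (hp t ht).continuousAt.continuousWithinAt)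
    (fun t ht => (hp t (Ico_subset_Icc_self ht)).hasDerivWithinAt) (by simp [hf0, hg0])
    (fun t ht => by
      rw [Prod.norm_def, Prod.norm_def]
      simp only [norm_neg, norm_mul]
      have h1 := hQ t (Ico_subset_Icc_self ht)
      refine max_le ?_ ?_
      · calc ‖g t‖ = 1 * ‖g t‖ := (one_mul _).symm
          _ ≤ _ := mul_le_mul (le_max_left _ _) (le_max_right _ _) (norm_nonneg _)
            (zero_le_one.trans (le_max_left _ _))
      · exact mul_le_mul (h1.trans (le_max_right _ _)) (le_max_left _ _) (norm_nonneg _)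
            (zero_le_one.trans (le_max_left _ _)))
  exact fun t ht => congrArg Prod.fst (this t ht)

/-- An eigenfunction `φ` equals `φ'(0) y` on `[0, π]` by uniqueness, where `y` is the solution
attached to the Prüfer angle; hence `φ'(0) ≠ 0` and `y` vanishes at `π` too. -/
lemma isDirichletEigenvalue_iff {V θ : ℝ → ℝ} {μ : ℝ} (hV : Continuous V)
    (h : IsPruferAngle (fun t => μ - V t) θ) : IsDirichletEigenvalue V μ ↔ sin (θ π) = 0 := by
  obtain ⟨y, hy2, hy0, hy1, hy, hyπ⟩ := h.exists_solution (by fun_prop)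
  have aux : ∀ φ : ℝ → ℝ, ContDiff ℝ 2 φ →
      (∀ t, HasDerivAt φ (deriv φ t) t) ∧ ∀ t, HasDerivAt (deriv φ) (deriv (deriv φ) t) t := by
    intro φ hφ
    rw [show (2 : WithTop ℕ∞) = 1 + 1 by norm_num, contDiff_succ_iff_deriv,
      contDiff_one_iff_deriv] at hφ
    exact ⟨fun t => (hφ.1 t).hasDerivAt, fun t => (hφ.2.2.1 t).hasDerivAt⟩
  rw [← hyπ]
  constructor
  · rintro ⟨φ, hφ2, hφ0, hφπ, ⟨x, hx, hφx⟩, hφ⟩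
    set c := deriv φ 0
    have hz := eq_zero_of_second_order (q := fun t => μ - V t) (f := fun t => φ t - c * y t)
      (g := fun t => deriv φ t - c * deriv y t) (by fun_prop)
      (fun t _ => ((aux φ hφ2).1 t).fun_sub (((aux y hy2).1 t).const_mul c))
      (fun t ht => by
        refine (((aux φ hφ2).2 t).fun_sub (((aux y hy2).2 t).const_mul c)).congr_deriv ?_
        rw [hy t ht]
        linear_combination -hφ t ht)
      (by simp [hφ0, hy0]) (by simp [hy1, c])
    have hc : c ≠ 0 := by
      rintro hc
      have := hz x hx
      simp only [hc, zero_mul, sub_zero] at this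
      exact hφx this
    have := hz π (right_mem_Icc.2 pi_pos.le)
    simpa [hφπ, hc] using this
  · intro hyπ0
    refine ⟨y, hy2, hy0, hyπ0, ?_, fun x hx => ?_⟩
    · by_contra! hzero
      have hw : HasDerivWithinAt y 0 (Icc 0 π) 0 :=
        (hasDerivWithinAt_const 0 (Icc 0 π) (0 : ℝ)).congr hzero hy0
      have := (uniqueDiffOn_Icc pi_pos 0 (left_mem_Icc.2 pi_pos.le)).eq_deriv _
        (((aux y hy2).1 0).hasDerivWithinAt) hw
      rw [hy1] at this
      exact one_ne_zero this
    · rw [hy x hx]; ring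

/-- The Dirichlet spectrum is enumerated by an increasing sequence asymptotic to `j²`. -/
theorem exists_spectrum {V : ℝ → ℝ} (hV : Continuous V) :
    ∃ lam : ℕ+ → ℝ, StrictMono lam ∧ (∃ C : ℝ, ∀ j, |lam j - (j : ℝ) ^ 2| ≤ C) ∧
      ∀ μ, IsDirichletEigenvalue V μ ↔ ∃ j, lam j = μ := by
  choose Θ hΘ using fun μ : ℝ =>
    exists_isPruferAngle (q := fun t => μ - V t) (by fun_prop)
  have hmono : StrictMono fun μ => Θ μ π := fun μ ν hμν =>
    (hΘ μ).lt_of_lt (hΘ ν) (by fun_prop) fun t _ => by simpa using hμν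
  have hcont := continuous_pruferAngle hV hΘ
  obtain ⟨C, hC⟩ := isCompact_Icc.exists_bound_of_continuousOn (s := Icc 0 π) hV.continuousOn
  have hC0 : 0 ≤ C := (norm_nonneg _).trans (hC 0 (left_mem_Icc.2 pi_pos.le))
  -- For `μ = j² ∓ C` the coefficient `μ - V` lies below, respectively above, `j²`, whose angle ends
  -- at `j π`; the intermediate value theorem then applies.
  have hex : ∀ j : ℕ+, ∃ μ ∈ Icc ((j : ℝ) ^ 2 - C) ((j : ℝ) ^ 2 + C), Θ μ π = j * π := by
    intro j
    obtain ⟨θ, hθ⟩ := exists_isPruferAngle (q := fun _ => ((j : ℕ) : ℝ) ^ 2) continuous_const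
    have hθπ := hθ.const_apply_pi j.pos
    have h1 : Θ ((j : ℝ) ^ 2 - C) π ≤ j * π := hθπ ▸ (hΘ _).le_of_le hθ (by fun_prop)
      fun t ht => by linarith [(abs_le.1 (hC t ht)).1]
    have h2 : j * π ≤ Θ ((j : ℝ) ^ 2 + C) π := hθπ ▸ hθ.le_of_le (hΘ _) (by fun_prop)
      fun t ht => by linarith [(abs_le.1 (hC t ht)).2]
    exact intermediate_value_Icc (by linarith) hcont.continuousOn ⟨h1, h2⟩
  choose lam hlam hlamπ using hex
  refine ⟨lam, fun i j hij => ?_, ⟨C, fun j => ?_⟩, fun μ => ?_⟩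
  · rw [← hmono.lt_iff_lt]
    simp only [hlamπ]
    exact mul_lt_mul_of_pos_right (by exact_mod_cast hij) pi_pos
  · rw [abs_le]; constructor <;> linarith [(hlam j).1, (hlam j).2]
  · rw [isDirichletEigenvalue_iff hV (hΘ μ), sin_eq_zero_iff]
    constructor
    · rintro ⟨n, hn⟩
      have hpos : 0 < Θ μ π := (hΘ μ).pos (by fun_prop)
      rw [← hn] at hpos
      have hn0 : 0 < n := by exact_mod_cast pos_of_mul_pos_left hpos pi_pos.le
      lift n to ℕ using hn0.le
      have hn1 : 0 < n := by exact_mod_cast hn0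
      refine ⟨n.toPNat hn1, hmono.injective ((hlamπ _).trans ?_)⟩
      rw [← hn]
      simp [Nat.toPNat]
    · rintro ⟨j, rfl⟩
      exact ⟨(j : ℕ), by rw [hlamπ]; simp⟩

lemma eigenvalue_eq {V : ℝ → ℝ} {lam : ℕ+ → ℝ} (hmono : StrictMono lam)
    (hspec : ∀ μ, IsDirichletEigenvalue V μ ↔ ∃ j, lam j = μ) (j : ℕ+) :
    eigenvalue V j = lam j := by
  have hset : ∀ x, {μ : ℝ | IsDirichletEigenvalue V μ ∧ μ ≤ x} = lam '' {i | lam i ≤ x} := by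
    intro x
    ext μ
    simp only [mem_ofPred_eq, hspec, mem_image]
    constructor
    · rintro ⟨⟨i, rfl⟩, h⟩; exact ⟨i, h, rfl⟩
    · rintro ⟨i, h, rfl⟩; exact ⟨⟨i, rfl⟩, h⟩
  have hIci : {x : ℝ | ((j : ℕ) : ℕ∞) ≤ {μ : ℝ | IsDirichletEigenvalue V μ ∧ μ ≤ x}.encard}
      = Ici (lam j) := by
    ext x
    simp only [mem_ofPred_eq, hset, hmono.injective.encard_image, mem_Ici]
    constructor
    · intro h
      by_contra! hx
      have hsub : {i | lam i ≤ x} ⊆ ((Finset.Ico 1 j : Finset ℕ+) : Set ℕ+) := by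
        intro i hi
        simp only [Finset.coe_Ico, mem_Ico, one_le, true_and]
        exact hmono.lt_iff_lt.1 (lt_of_le_of_lt hi hx)
      have := h.trans (encard_le_encard hsub)
      rw [encard_coe_eq_coe_finsetCard, PNat.card_Ico] at this
      have h2 : (j : ℕ) ≤ j - 1 := by exact_mod_cast this
      have := j.pos
      omega
    · intro hx
      have hsub : ((Finset.Icc 1 j : Finset ℕ+) : Set ℕ+) ⊆ {i | lam i ≤ x} := by
        intro i hi
        simp only [Finset.coe_Icc, mem_Icc] at hi
        exact (hmono.monotone hi.2).trans hx
      refine le_trans ?_ (encard_le_encard hsub)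
      rw [encard_coe_eq_coe_finsetCard, PNat.card_Icc]
      simp
  rw [eigenvalue, hIci, csInf_Ici]

lemma threshold_eq {V : ℝ → ℝ} {lam : ℕ+ → ℝ} (hmono : StrictMono lam)
    (hspec : ∀ μ, IsDirichletEigenvalue V μ ↔ ∃ j, lam j = μ) : threshold V = -lam 1 := by
  simp only [threshold, eigenvalue_eq hmono hspec]
  congr 1
  have hle : ∀ j, lam 1 ≤ lam j := fun j => hmono.monotone one_le
  exact le_antisymm (ciInf_le ⟨lam 1, by rintro _ ⟨j, rfl⟩; exact hle j⟩ 1) (le_ciInf hle)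

end DirichletNLW

namespace DirichletNLW

open Set

/-! ### Sublevel sets of sums of powers -/

/-- A compact set of measure more than `n δ` contains `n` points at mutual distance `≥ δ`. -/
lemma exists_separated {δ : ℝ} (hδ : 0 ≤ δ) (n : ℕ) : ∀ {S : Set ℝ}, IsCompact S →
    ENNReal.ofReal (n * δ) < volume S →
    ∃ x : ℕ → ℝ, (∀ i < n, x i ∈ S) ∧ ∀ i, i + 1 < n → x i + δ ≤ x (i + 1) := by
  induction n with
  | zero => exact fun _ _ => ⟨0, by simp, by simp⟩
  | succ n ih =>
    intro S hS hv
    have hne : S.Nonempty := by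
      by_contra h
      rw [not_nonempty_iff_eq_empty] at h
      simp [h] at hv
    obtain ⟨x₀, hx₀, hmin⟩ := hS.exists_isLeast hne
    -- Greedy choice: keep the least point and discard an interval of length `δ` after it.
    have hsub : S ⊆ Icc x₀ (x₀ + δ) ∪ S ∩ Ici (x₀ + δ) := by
      intro y hy
      rcases le_total y (x₀ + δ) with h | h
      · exact Or.inl ⟨hmin hy, h⟩
      · exact Or.inr ⟨hy, h⟩
    have hv' : ENNReal.ofReal (n * δ) < volume (S ∩ Ici (x₀ + δ)) := by
      by_contra! hle
      refine absurd hv (not_lt.2 ?_)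
      calc volume S ≤ volume (Icc x₀ (x₀ + δ)) + volume (S ∩ Ici (x₀ + δ)) :=
            (measure_mono hsub).trans (measure_union_le _ _)
        _ ≤ ENNReal.ofReal δ + ENNReal.ofReal (n * δ) := by
            rw [Real.volume_Icc, add_sub_cancel_left]; gcongr
        _ = ENNReal.ofReal ((n + 1 : ℕ) * δ) := by
            rw [← ENNReal.ofReal_add hδ (by positivity)]; congr 1; push_cast; ring
    obtain ⟨x, hxS, hx⟩ := ih (hS.inter_right isClosed_Ici) hv'
    refine ⟨fun i => Nat.casesOn i x₀ x, fun i hi => ?_, fun i hi => ?_⟩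
    · cases i with
      | zero => exact hx₀
      | succ i => exact (hxS i (by omega)).1
    · cases i with
      | zero => exact (hxS 0 (by omega)).2
      | succ i => exact hx i (by omega)

/-- Between consecutive separated points at which `g` is small, its derivative is small
somewhere. -/
lemma exists_separated_deriv {a b δ ε : ℝ} (hδ : 0 < δ) {g g' : ℝ → ℝ} {n : ℕ} {x : ℕ → ℝ}
    (hg : ∀ m ∈ Icc a b, HasDerivAt g (g' m) m)
    (hxI : ∀ i < 2 * n, x i ∈ Icc a b ∧ |g (x i)| ≤ ε)
    (hx : ∀ i, i + 1 < 2 * n → x i + δ ≤ x (i + 1)) :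
    ∃ y : ℕ → ℝ, (∀ i < n, y i ∈ Icc a b ∧ |g' (y i)| ≤ 2 * ε / δ) ∧
      ∀ i, i + 1 < n → y i + δ ≤ y (i + 1) := by
  -- The points are paired as `(x (2i), x (2i+1))`; the unused gaps between pairs keep the new
  -- points `δ` apart.
  have key : ∀ i, ∃ y, i < n → y ∈ Ioo (x (2 * i)) (x (2 * i + 1)) ∧ |g' y| ≤ 2 * ε / δ := by
    intro i
    by_cases hi : i < n
    swap
    · exact ⟨0, fun h => absurd h hi⟩
    have h1 := hxI (2 * i) (by omega)
    have h2 := hxI (2 * i + 1) (by omega)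
    have h3 := hx (2 * i) (by omega)
    have hsub : Icc (x (2 * i)) (x (2 * i + 1)) ⊆ Icc a b := Icc_subset_Icc h1.1.1 h2.1.2
    obtain ⟨y, hy, hgy⟩ := exists_hasDerivAt_eq_slope g g' (by linarith)
      (fun m hm => (hg m (hsub hm)).continuousAt.continuousWithinAt)
      (fun m hm => hg m (hsub (Ioo_subset_Icc_self hm)))
    refine ⟨y, fun _ => ⟨hy, ?_⟩⟩
    have hε : 0 ≤ ε := (abs_nonneg _).trans h1.2
    rw [hgy, abs_div, abs_of_pos (show 0 < x (2 * i + 1) - x (2 * i) by linarith)]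
    refine div_le_div₀ (by positivity) ?_ hδ (by linarith)
    exact (abs_sub _ _).trans (by linarith [h1.2, h2.2])
  choose y hy using key
  refine ⟨y, fun i hi => ⟨?_, (hy i hi).2⟩, fun i hi => ?_⟩
  · exact ⟨(hxI (2 * i) (by omega)).1.1.trans (hy i hi).1.1.le,
      (hy i hi).1.2.le.trans (hxI (2 * i + 1) (by omega)).1.2⟩
  · have h1 := (hy i (by omega)).1.2
    have h2 := (hy (i + 1) hi).1.1
    have h3 := hx (2 * i + 1) (by omega)
    rw [show 2 * (i + 1) = 2 * i + 1 + 1 by ring] at h2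
    linarith

variable {ι : Type*} [DecidableEq ι]

/-- Dividing a sum of `p`-th powers by one of the powers and differentiating eliminates that
term and lowers the exponent. -/
lemma hasDerivAt_sum_rpow {l c : ι → ℝ} {S : Finset ι} {i : ι} (hi : i ∈ S) {m : ℝ} (p : ℝ)
    (hpos : ∀ j ∈ S, 0 < l j + m) :
    HasDerivAt (fun m => (l i + m) ^ (-p) * ∑ j ∈ S, c j * (l j + m) ^ p)
      ((l i + m) ^ (-p - 1) *
        ∑ j ∈ S.erase i, (p * (l i - l j) * c j) * (l j + m) ^ (p - 1)) m := by
  have hd : ∀ j ∈ S, ∀ q : ℝ, HasDerivAt (fun m => (l j + m) ^ q) (q * (l j + m) ^ (q - 1)) m := by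
    intro j hj q
    simpa using! ((hasDerivAt_id m).const_add (l j)).rpow_const (p := q) (Or.inl (hpos j hj).ne')
  have hsum := HasDerivAt.fun_sum fun j hj => (hd j hj p).const_mul (c j)
  refine ((hd i hi (-p)).fun_mul hsum).congr_deriv ?_
  have h1 : ∀ j ∈ S, (l j + m) ^ p = (l j + m) * (l j + m) ^ (p - 1) := fun j hj => by
    rw [Real.rpow_sub_one (hpos j hj).ne']; field_simp [(hpos j hj).ne']
  have h2 : (l i + m) ^ (-p) = (l i + m) * (l i + m) ^ (-p - 1) := by
    rw [Real.rpow_sub_one (hpos i hi).ne']; field_simp [(hpos i hi).ne']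
  rw [h2]
  have h3 : ∑ j ∈ S.erase i, (p * (l i - l j) * c j) * (l j + m) ^ (p - 1)
      = ∑ j ∈ S, (p * (l i - l j) * c j) * (l j + m) ^ (p - 1) := by
    rw [← Finset.add_sum_erase S _ hi]; simp
  rw [h3, Finset.mul_sum, Finset.mul_sum, Finset.mul_sum, ← Finset.sum_add_distrib]
  refine Finset.sum_congr rfl fun j hj => ?_
  rw [h1 j hj]
  ring

/-- A nondegenerate sum of negative powers cannot be too small at many separated points. -/
lemma sum_rpow_lower_bound {l : ι → ℝ} {a b d δ B R : ℝ} (hd : 0 < d) (hδ : 0 < δ) (hB : 1 ≤ B)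
    (s : ℕ) : ∀ {S : Finset ι} {c : ι → ℝ} {p c₀ ε : ℝ} {x : ℕ → ℝ}, S.card = s + 1 →
    p ≤ -1 / 2 → -p + s ≤ R → (∀ j ∈ S, c₀ ≤ |c j|) → 0 ≤ c₀ →
    (∀ j ∈ S, ∀ m ∈ Icc a b, 0 < l j + m ∧ ∀ q : ℝ, |q| ≤ R → (l j + m) ^ q ≤ B) →
    (∀ i ∈ S, ∀ j ∈ S, i ≠ j → d ≤ |l i - l j|) →
    (∀ i < 2 ^ s, x i ∈ Icc a b ∧ |∑ j ∈ S, c j * (l j + x i) ^ p| ≤ ε) →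
    (∀ i, i + 1 < 2 ^ s → x i + δ ≤ x (i + 1)) →
    c₀ * (d * δ) ^ s ≤ ε * (4 * B ^ 2) ^ s * B := by
  induction s with
  | zero =>
    intro S c p c₀ ε x hS hp hR hc hc₀ hl hsep hx _
    obtain ⟨j, rfl⟩ := Finset.card_eq_one.1 hS
    obtain ⟨hxI, hxε⟩ := hx 0 (by simp)
    obtain ⟨hpos, hlB⟩ := hl j (by simp) _ hxI
    have hc' := hc j (by simp)
    simp only [Finset.sum_singleton, abs_mul, abs_of_pos (Real.rpow_pos_of_pos hpos p)] at hxε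
    have h1 := hlB (-p) (by rw [abs_of_nonneg (by linarith)]; simpa using hR)
    have h2 : (l j + x 0) ^ p * (l j + x 0) ^ (-p) = 1 := by
      rw [← Real.rpow_add hpos, add_neg_cancel, Real.rpow_zero]
    have hε : 0 ≤ ε := le_trans (by positivity) hxε
    simp only [pow_zero, mul_one]
    calc c₀ ≤ |c j| := hc'
      _ = |c j| * (l j + x 0) ^ p * (l j + x 0) ^ (-p) := by rw [mul_assoc, h2, mul_one]
      _ ≤ ε * B := mul_le_mul hxε h1 (by positivity) hε
  | succ s ih =>
    intro S c p c₀ ε x hS hp hR hc hc₀ hl hsep hx hxδ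
    push_cast at hR
    have hs0 : (0 : ℝ) ≤ s := Nat.cast_nonneg s
    obtain ⟨i, hi⟩ : S.Nonempty := Finset.card_pos.1 (by omega)
    have hε : 0 ≤ ε := (abs_nonneg _).trans (hx 0 (by positivity)).2
    obtain ⟨y, hy, hyδ⟩ := exists_separated_deriv (a := a) (b := b) (ε := B * ε) (n := 2 ^ s) hδ
      (fun m hm => hasDerivAt_sum_rpow (c := c) hi p fun j hj => (hl j hj m hm).1)
      (x := x) (fun k hk => by
        obtain ⟨hxI, hxε⟩ := hx k (by rw [pow_succ]; omega)
        obtain ⟨hpos, hlB⟩ := hl i hi _ hxI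
        refine ⟨hxI, ?_⟩
        rw [abs_mul, abs_of_pos (Real.rpow_pos_of_pos hpos _)]
        exact mul_le_mul (hlB _ (by rw [abs_of_nonneg (by linarith)]; linarith)) hxε
          (abs_nonneg _) (by linarith))
      (fun k hk => hxδ k (by rw [pow_succ]; omega))
    -- Since `p ≤ -1/2` only decreases, differentiation never produces a zero factor: new
    -- coefficients are at least `d c₀ / 2`. The quantity `-p + s` is unchanged, so the bound `R` on
    -- exponents persists.
    have key := ih (S := S.erase i) (c := fun j => p * (l i - l j) * c j) (p := p - 1)
      (c₀ := c₀ * d / 2) (ε := B * (2 * (B * ε) / δ)) (x := y)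
      (by rw [Finset.card_erase_of_mem hi, hS]; rfl) (by linarith) (by linarith)
      (fun j hj => by
        have hj' := Finset.mem_of_mem_erase hj
        have h1 := hsep i hi j hj' (Finset.ne_of_mem_erase hj).symm
        have h2 := hc j hj'
        have h3 : 1 / 2 ≤ |p| := by rw [abs_of_nonpos (by linarith)]; linarith
        rw [abs_mul, abs_mul]
        calc c₀ * d / 2 = 1 / 2 * d * c₀ := by ring
          _ ≤ |p| * |l i - l j| * |c j| := by gcongr)
      (by positivity) (fun j hj => hl j (Finset.mem_of_mem_erase hj))
      (fun j hj k hk => hsep j (Finset.mem_of_mem_erase hj) k (Finset.mem_of_mem_erase hk))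
      (fun k hk => by
        obtain ⟨hyI, hyε⟩ := hy k hk
        obtain ⟨hpos, hlB⟩ := hl i hi _ hyI
        refine ⟨hyI, ?_⟩
        have h1 : (l i + y k) ^ (p + 1) * (l i + y k) ^ (-p - 1) = 1 := by
          rw [← Real.rpow_add hpos]; ring_nf; exact Real.rpow_zero _
        rw [abs_mul, abs_of_pos (Real.rpow_pos_of_pos hpos _)] at hyε
        calc _ = (l i + y k) ^ (p + 1) * ((l i + y k) ^ (-p - 1) *
              |∑ j ∈ S.erase i, p * (l i - l j) * c j * (l j + y k) ^ (p - 1)|) := by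
              rw [← mul_assoc, h1, one_mul]
          _ ≤ B * (2 * (B * ε) / δ) := mul_le_mul
              (hlB _ (abs_le.2 ⟨by linarith, by linarith⟩)) hyε (by positivity) (by linarith))
      hyδ
    calc c₀ * (d * δ) ^ (s + 1) = 2 * δ * (c₀ * d / 2 * (d * δ) ^ s) := by ring
      _ ≤ 2 * δ * (B * (2 * (B * ε) / δ) * (4 * B ^ 2) ^ s * B) := by gcongr
      _ = ε * (4 * B ^ 2) ^ (s + 1) * B := by field_simp; ring

/-- Sublevel sets of integer combinations of frequencies and a constant have small measure. -/
lemma volume_sublevel_le {l : ι → ℝ} {a b d δ B ε : ℝ} (hd : 0 < d) (hd1 : d ≤ 1) (hδ : 0 < δ)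
    (hδ1 : δ ≤ 1) (hB : 1 ≤ B) (R : ℕ) {S : Finset ι} (hS : S.Nonempty) (hSR : S.card ≤ R)
    {k : ι → ℝ} (hk : ∀ j ∈ S, 1 ≤ |k j|) (n : ℝ)
    (hl : ∀ j ∈ S, ∀ m ∈ Icc a b, 0 < l j + m ∧ ∀ q : ℝ, |q| ≤ R → (l j + m) ^ q ≤ B)
    (hsep : ∀ i ∈ S, ∀ j ∈ S, i ≠ j → d ≤ |l i - l j|)
    (hε : ε * (4 * (4 * B ^ 2) ^ R * B) < (d * δ) ^ R) :
    volume {m ∈ Icc a b | |∑ j ∈ S, √(l j + m) * k j + n| ≤ ε} ≤ ENNReal.ofReal (2 ^ R * δ) := by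
  set f : ℝ → ℝ := fun m => ∑ j ∈ S, √(l j + m) * k j + n
  by_contra! hv
  have hfc : Continuous f := by fun_prop
  have hcomp : IsCompact {m ∈ Icc a b | |f m| ≤ ε} :=
    isCompact_Icc.inter_right (isClosed_le hfc.abs continuous_const)
  obtain ⟨x, hx, hxδ⟩ := exists_separated hδ.le (2 ^ R) hcomp (by exact_mod_cast hv)
  obtain ⟨s, hs⟩ : ∃ s, S.card = s + 1 := ⟨S.card - 1, by have := hS.card_pos; omega⟩
  have hpow : 2 * 2 ^ s ≤ 2 ^ R := by
    rw [← pow_succ']; exact Nat.pow_le_pow_right (by norm_num) (by omega)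
  -- This first derivative removes the constant `n` and starts the induction at `p = -1/2` with `c₀
  -- = 1/2`.
  have hf : ∀ m ∈ Icc a b,
      HasDerivAt f (∑ j ∈ S, (k j / 2) * (l j + m) ^ (-1 / 2 : ℝ)) m := by
    intro m hm
    refine ((HasDerivAt.fun_sum fun j hj => ((((hasDerivAt_id m).const_add (l j)).sqrt
      (hl j hj m hm).1.ne').mul_const (k j))).add_const n).congr_deriv ?_
    refine Finset.sum_congr rfl fun j hj => ?_
    rw [show (-1 / 2 : ℝ) = -(1 / 2) by norm_num, Real.rpow_neg (hl j hj m hm).1.le,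
      ← Real.sqrt_eq_rpow]
    simp only [id]
    ring
  obtain ⟨y, hy, hyδ⟩ := exists_separated_deriv hδ hf (n := 2 ^ s) (x := x) (ε := ε)
    (fun i hi => hx i (hi.trans_le hpow)) (fun i hi => hxδ i (hi.trans_le hpow))
  have hε0 : 0 ≤ ε := (abs_nonneg _).trans (hx 0 (by positivity)).2
  have hsR : (s : ℝ) + 1 ≤ R := by exact_mod_cast hs ▸ hSR
  have key := sum_rpow_lower_bound (c₀ := 1 / 2) hd hδ hB s hs le_rfl (by linarith)
    (fun j hj => by
      have := hk j hj
      rw [abs_div, abs_two]; linarith) (by norm_num) hl hsep hy hyδ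
  have hdδ : d * δ ≤ 1 := mul_le_one₀ hd1 hδ.le hδ1
  have h4B : 1 ≤ 4 * B ^ 2 := by nlinarith
  have hsR' : s + 1 ≤ R := hs ▸ hSR
  refine absurd hε (not_lt.2 ?_)
  calc (d * δ) ^ R ≤ (d * δ) ^ (s + 1) := pow_le_pow_of_le_one (by positivity) hdδ hsR'
    _ = (2 * δ * d) * (1 / 2 * (d * δ) ^ s) := by ring
    _ ≤ (2 * δ * d) * (2 * ε / δ * (4 * B ^ 2) ^ s * B) := by gcongr
    _ = ε * (4 * (4 * B ^ 2) ^ s * B) * d := by field_simp; ring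
    _ ≤ ε * (4 * (4 * B ^ 2) ^ s * B) := mul_le_of_le_one_right (by positivity) hd1
    _ ≤ ε * (4 * (4 * B ^ 2) ^ R * B) := by
      gcongr
      omega

/-! ### Small divisors -/

/-- There are polynomially many integer vectors of bounded length supported in a finite set. -/
lemma exists_finset_of_sum_abs_le {ι : Type*} [DecidableEq ι] {s : Finset ι} (hs : s.Nonempty)
    (n : ℕ) : ∃ K : Finset (ι →₀ ℤ), K.card ≤ (3 * s.card) ^ n ∧
      ∀ k : ι →₀ ℤ, k.support ⊆ s → ∑ j ∈ s, |k j| ≤ n → k ∈ K := by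
  induction n with
  | zero =>
    refine ⟨{0}, by simp, fun k hk hsum => ?_⟩
    rw [Finset.mem_singleton]
    ext j
    by_cases hj : j ∈ s
    · have := (Finset.sum_eq_zero_iff_of_nonneg fun i _ => abs_nonneg (k i)).1
        (le_antisymm (by simpa using hsum) (Finset.sum_nonneg fun i _ => abs_nonneg (k i))) j hj
      simpa using this
    · simpa using fun h => hj (hk (Finsupp.mem_support_iff.2 h))
  | succ n ih =>
    obtain ⟨K, hKc, hK⟩ := ih
    refine ⟨(K ×ˢ s ×ˢ ({-1, 0, 1} : Finset ℤ)).image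
      fun p => p.1 + Finsupp.single p.2.1 p.2.2, ?_, fun k hk hsum => ?_⟩
    -- A nonzero vector is a shorter one plus `±1` in one coordinate; the increment `0` accounts for
    -- the zero vector.
    · refine Finset.card_image_le.trans ?_
      rw [Finset.card_product, Finset.card_product, pow_succ]
      refine Nat.mul_le_mul hKc ?_
      simp [mul_comm]
    · rw [Finset.mem_image]
      by_cases hk0 : k = 0
      · obtain ⟨j, hj⟩ := hs
        refine ⟨(0, j, 0), ?_, by simp [hk0]⟩
        simp [hj, hK 0 (by simp) (by simp)]
      · obtain ⟨j, hj⟩ := Finsupp.support_nonempty_iff.2 hk0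
        have hjs := hk hj
        have hkj : k j ≠ 0 := Finsupp.mem_support_iff.1 hj
        refine ⟨(k - Finsupp.single j (SignType.sign (k j) : ℤ), j, (SignType.sign (k j) : ℤ)),
          ?_, by simp⟩
        simp only [Finset.mem_product]
        refine ⟨hK _ ?_ ?_, hjs, ?_⟩
        · intro i hi
          by_cases hij : i = j
          · exact hij ▸ hjs
          · refine hk (Finsupp.mem_support_iff.2 ?_)
            rw [Finsupp.mem_support_iff, Finsupp.sub_apply, Finsupp.single_eq_of_ne hij] at hi
            simpa using hi
        · rw [← Finset.add_sum_erase s _ hjs] at hsum ⊢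
          have h1 : ∑ i ∈ s.erase j, |(k - Finsupp.single j (SignType.sign (k j) : ℤ)) i|
              = ∑ i ∈ s.erase j, |k i| := by
            refine Finset.sum_congr rfl fun i hi => ?_
            rw [Finsupp.sub_apply, Finsupp.single_eq_of_ne (Finset.ne_of_mem_erase hi), sub_zero]
          have h2 : |(k - Finsupp.single j (SignType.sign (k j) : ℤ)) j| = |k j| - 1 := by
            rw [Finsupp.sub_apply, Finsupp.single_eq_same]
            rcases lt_or_gt_of_ne hkj with h | h
            · simp only [sign_neg h, SignType.coe_neg_one]
              rw [abs_of_neg h, abs_of_nonpos (by omega)]; ring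
            · simp only [sign_pos h, SignType.coe_one]
              rw [abs_of_pos h, abs_of_nonneg (by omega)]
          rw [h1, h2]
          push_cast at hsum
          linarith
        · rcases lt_or_gt_of_ne hkj with h | h
          · simp [sign_neg h]
          · simp [sign_pos h]

lemma rpow_le_of_abs_le {x H q : ℝ} {R : ℕ} (hH : 1 ≤ H) (hx : 1 / H ≤ x) (hxH : x ≤ H)
    (hq : |q| ≤ R) : x ^ q ≤ H ^ R := by
  have hx0 : 0 < x := lt_of_lt_of_le (by positivity) hx
  rw [← Real.rpow_natCast]
  rcases le_total 0 q with h | h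
  · rw [abs_of_nonneg h] at hq
    exact (Real.rpow_le_rpow hx0.le hxH h).trans (Real.rpow_le_rpow_of_exponent_le hH hq)
  · rw [abs_of_nonpos h] at hq
    have h1 : x⁻¹ ≤ H := inv_le_of_inv_le₀ (by positivity) (by simpa using hx)
    calc x ^ q = x⁻¹ ^ (-q) := by rw [Real.inv_rpow hx0.le, Real.rpow_neg hx0.le, inv_inv]
      _ ≤ H ^ (-q) := Real.rpow_le_rpow (by positivity) h1 (by linarith)
      _ ≤ _ := Real.rpow_le_rpow_of_exponent_le hH hq

/-- A sequence at bounded distance from `j²` is uniformly separated. -/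
lemma exists_separation {lam : ℕ+ → ℝ} (hmono : StrictMono lam) {C : ℝ}
    (hC : ∀ j, |lam j - (j : ℝ) ^ 2| ≤ C) :
    ∃ d : ℝ, 0 < d ∧ d ≤ 1 ∧ ∀ i j, i ≠ j → d ≤ |lam i - lam j| := by
  have hfin : ∀ M : ℕ, ∃ d : ℝ, 0 < d ∧ d ≤ 1 ∧ ∀ i : ℕ+, (i : ℕ) < M →
      d ≤ lam (i + 1) - lam i := by
    intro M
    induction M with
    | zero => exact ⟨1, one_pos, le_rfl, by simp⟩
    | succ M ih =>
      obtain ⟨d, hd0, hd1, hd⟩ := ih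
      rcases Nat.eq_zero_or_pos M with rfl | hM
      · exact ⟨d, hd0, hd1, fun i hi => absurd hi (by have := i.pos; omega)⟩
      · set I : ℕ+ := M.toPNat hM
        have hI : 0 < lam (I + 1) - lam I := sub_pos.2 (hmono (PNat.lt_add_right I 1))
        refine ⟨min d (lam (I + 1) - lam I), lt_min hd0 hI, (min_le_left _ _).trans hd1,
          fun i hi => ?_⟩
        rcases Nat.lt_succ_iff_lt_or_eq.1 hi with h | h
        · exact (min_le_left _ _).trans (hd i h)
        · have : i = I := PNat.eq h
          exact this ▸ min_le_right _ _
  -- For `i ≥ M` the gap is at least `2 i + 1 - 2 C ≥ 1`; only finitely many gaps remain.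
  obtain ⟨M, hM⟩ := exists_nat_gt C
  obtain ⟨d, hd0, hd1, hd⟩ := hfin M
  have hgap : ∀ i : ℕ+, d ≤ lam (i + 1) - lam i := by
    intro i
    by_cases hi : (i : ℕ) < M
    · exact hd i hi
    · have h1 := (abs_le.1 (hC (i + 1))).1
      have h2 := (abs_le.1 (hC i)).2
      have h3 : (M : ℝ) ≤ i := by exact_mod_cast not_lt.1 hi
      push_cast at h1
      nlinarith
  have hlt : ∀ i j, i < j → d ≤ lam j - lam i := fun i j hij =>
    (hgap i).trans (sub_le_sub_right (hmono.monotone (PNat.add_one_le_iff.2 hij)) _)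
  refine ⟨d, hd0, hd1, fun i j hij => ?_⟩
  rcases lt_or_gt_of_ne hij with h | h
  · rw [abs_sub_comm]; exact (hlt i j h).trans (le_abs_self _)
  · exact (hlt j i h).trans (le_abs_self _)

/-- Polynomial two-sided bounds for the squared frequencies. -/
lemma exists_frequency_bounds {lam : ℕ+ → ℝ} (hmono : StrictMono lam) {C : ℝ}
    (hC : ∀ j, |lam j - (j : ℝ) ^ 2| ≤ C) {a b : ℝ} (ha : 0 < lam 1 + a) :
    ∃ Q : ℕ, 1 ≤ Q ∧ ∀ N : ℕ, 1 ≤ N → ∀ j : ℕ+, (j : ℕ) ≤ N → ∀ m ∈ Icc a b,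
      1 / ((Q : ℝ) * N ^ 2) ≤ lam j + m ∧ lam j + m ≤ Q * N ^ 2 := by
  obtain ⟨Q, hQ⟩ := exists_nat_gt (max (1 / (lam 1 + a)) (1 + C + |b|))
  have hQ1 := (le_max_left _ _).trans hQ.le
  have hQ2 := (le_max_right _ _).trans hQ.le
  have hC0 : 0 ≤ C := (abs_nonneg _).trans (hC 1)
  have hQ3 : (1 : ℝ) ≤ Q := by linarith [abs_nonneg b]
  refine ⟨Q, by exact_mod_cast hQ3, fun N hN j hj m hm => ?_⟩
  have hN' : (1 : ℝ) ≤ (N : ℝ) ^ 2 := one_le_pow₀ (by exact_mod_cast hN)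
  constructor
  · have h1 : lam 1 + a ≤ lam j + m := add_le_add (hmono.monotone one_le) hm.1
    refine le_trans ?_ h1
    rw [one_div, inv_le_comm₀ (by positivity) ha, ← one_div]
    nlinarith
  · have h1 := (abs_le.1 (hC j)).2
    have h2 : (j : ℝ) ^ 2 ≤ (N : ℝ) ^ 2 := by gcongr
    have h3 := hm.2.trans (le_abs_self b)
    nlinarith [abs_nonneg b]

/-- Almost every mass satisfies the small divisor estimate with an integer shift. -/
theorem ae_small_divisor_bound {lam : ℕ+ → ℝ} (hmono : StrictMono lam) {C : ℝ}
    (hC : ∀ j, |lam j - (j : ℝ) ^ 2| ≤ C) {a b : ℝ} (ha : 0 < lam 1 + a) (R : ℕ) :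
    ∃ τ : ℕ, ∀ᵐ m : ℝ, m ∈ Icc a b → ∀ᶠ N : ℕ in atTop, ∀ k : ℕ+ →₀ ℤ, k ≠ 0 →
      ∑ j ∈ k.support, |k j| ≤ R → (∀ j ∈ k.support, (j : ℕ) ≤ N) → ∀ n : ℤ,
        1 / (N : ℝ) ^ τ < |∑ j ∈ k.support, √(lam j + m) * (k j : ℝ) + n| := by
  obtain ⟨d, hd0, hd1, hd⟩ := exists_separation hmono hC
  obtain ⟨Q, hQ1, hQ⟩ := exists_frequency_bounds hmono hC (b := b) ha
  have hQ1' : (1 : ℝ) ≤ Q := by exact_mod_cast hQ1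
  -- With `B = (Q N²) ^ R`, the first summand pays for the powers of `B`, the second for `δ ^ R`,
  -- and the final `1` absorbs the constant `A / d ^ R` once `N ≥ N₁`.
  set τ : ℕ := 2 * R * (2 * R + 1) + R * (R + 4) + 1 with hτ
  set A : ℝ := 4 * 4 ^ R * ((Q : ℝ) ^ R) ^ (2 * R + 1) with hA
  obtain ⟨N₁, hN₁⟩ := exists_nat_gt (A / d ^ R)
  set bad : ℕ → Set ℝ := fun N => {m | m ∈ Icc a b ∧ max N₁ 1 ≤ N ∧ ∃ k : ℕ+ →₀ ℤ, k ≠ 0 ∧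
      ∑ j ∈ k.support, |k j| ≤ R ∧ (∀ j ∈ k.support, (j : ℕ) ≤ N) ∧ ∃ n : ℤ,
        |∑ j ∈ k.support, √(lam j + m) * (k j : ℝ) + n| ≤ 1 / (N : ℝ) ^ τ}
  set c : ℝ := 6 ^ R * (2 * R * Q + 3)
  have hbad : ∀ N, volume (bad N) ≤ ENNReal.ofReal (c * (1 / (N : ℝ) ^ 2)) := by
    intro N
    by_cases hN : max N₁ 1 ≤ N
    swap
    · have : bad N = ∅ := by
        ext m; simp only [bad, hN, false_and, and_false]; simp
      simp [this]
    have hN1 : 1 ≤ N := (le_max_right _ _).trans hN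
    have hNN₁ : N₁ ≤ N := (le_max_left _ _).trans hN
    have hN1' : (1 : ℝ) ≤ N := by exact_mod_cast hN1
    have hN0 : (0 : ℝ) < N := by linarith
    set H : ℕ := Q * N ^ 2
    have hH : (H : ℝ) = Q * (N : ℝ) ^ 2 := by simp [H]
    have hH1 : (1 : ℝ) ≤ H := by
      rw [hH]
      exact one_le_mul_of_one_le_of_one_le hQ1' (one_le_pow₀ hN1')
    -- There are `O(N ^ R)` vectors `k` and `O(N²)` shifts `n`, so this `δ` leaves a total measure
    -- `O(N⁻²)`, which is summable.
    set δ : ℝ := 1 / (N : ℝ) ^ (R + 4)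
    set s : Finset ℕ+ := Finset.Icc 1 (N.toPNat hN1)
    have hs : ∀ j : ℕ+, j ∈ s ↔ (j : ℕ) ≤ N := fun j => by
      simp only [s, Finset.mem_Icc, one_le, true_and]
      exact PNat.coe_le_coe j (N.toPNat hN1)
    have hscard : s.card = N := by
      rw [PNat.card_Icc]; simp [Nat.toPNat]
    obtain ⟨K, hKc, hK⟩ := exists_finset_of_sum_abs_le (s := s)
      ⟨1, (hs 1).2 (by simpa using hN1)⟩ R
    -- The frequency sum is at most `R H`, so a larger shift cannot give a value of modulus at most
    -- `1`.
    set J : Finset ℤ := Finset.Icc (-(R * H + 1 : ℤ)) (R * H + 1)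
    have hJc : J.card = 2 * (R * H) + 3 := by
      simp only [J, Int.card_Icc]
      have : (R * H + 1 + 1 - -(R * H + 1) : ℤ) = ((2 * (R * H) + 3 : ℕ) : ℤ) := by push_cast; ring
      rw [this, Int.toNat_natCast]
    set P : Finset (ℕ+ →₀ ℤ) := K.filter fun k => k ≠ 0 ∧ ∑ j ∈ k.support, |k j| ≤ R ∧
      ∀ j ∈ k.support, (j : ℕ) ≤ N
    have hsub : bad N ⊆ ⋃ k ∈ P, ⋃ n ∈ J,
        {m ∈ Icc a b | |∑ j ∈ k.support, √(lam j + m) * (k j : ℝ) + ((n : ℤ) : ℝ)|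
          ≤ 1 / (N : ℝ) ^ τ} := by
      rintro m ⟨hm, -, k, hk0, hkR, hkN, n, hn⟩
      have hkK : k ∈ K := by
        refine hK k (fun j hj => (hs j).2 (hkN j hj)) ?_
        rwa [← Finset.sum_subset (s₁ := k.support) (fun j hj => (hs j).2 (hkN j hj))]
        intro j _ hj
        simp [Finsupp.notMem_support_iff.1 hj]
      have hkP : k ∈ P := Finset.mem_filter.2 ⟨hkK, hk0, hkR, hkN⟩
      have hnJ : n ∈ J := by
        have h1 : |∑ j ∈ k.support, √(lam j + m) * (k j : ℝ)| ≤ R * H := by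
          calc _ ≤ ∑ j ∈ k.support, |√(lam j + m) * (k j : ℝ)| := Finset.abs_sum_le_sum_abs _ _
            _ ≤ ∑ j ∈ k.support, H * |(k j : ℝ)| := by
              refine Finset.sum_le_sum fun j hj => ?_
              rw [abs_mul, abs_of_nonneg (Real.sqrt_nonneg _)]
              gcongr
              rw [Real.sqrt_le_left (by linarith)]
              have := (hQ N hN1 j (hkN j hj) m hm).2
              rw [← hH] at this
              nlinarith
            _ = H * ((∑ j ∈ k.support, |k j| : ℤ) : ℝ) := by
              rw [← Finset.mul_sum]; push_cast; rfl
            _ ≤ H * ((R : ℤ) : ℝ) := by gcongr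
            _ = R * H := by push_cast; ring
        have h2 : 1 / (N : ℝ) ^ τ ≤ 1 := by
          rw [div_le_one (by positivity)]; exact one_le_pow₀ hN1'
        have h3 : |(n : ℝ)| ≤ R * H + 1 := by
          have := abs_sub (∑ j ∈ k.support, √(lam j + m) * (k j : ℝ) + n)
            (∑ j ∈ k.support, √(lam j + m) * (k j : ℝ))
          rw [add_sub_cancel_left] at this
          linarith
        have h4 : |n| ≤ R * H + 1 := by exact_mod_cast h3
        exact Finset.mem_Icc.2 (abs_le.1 h4)
      simp only [mem_iUnion]
      exact ⟨k, hkP, n, hnJ, hm, hn⟩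
    have heach : ∀ k ∈ P, ∀ n ∈ J,
        volume {m ∈ Icc a b | |∑ j ∈ k.support, √(lam j + m) * (k j : ℝ) + ((n : ℤ) : ℝ)|
          ≤ 1 / (N : ℝ) ^ τ} ≤ ENNReal.ofReal (2 ^ R * δ) := by
      intro k hk n _
      obtain ⟨-, hk0, hkR, hkN⟩ := Finset.mem_filter.1 hk
      have hk1 : ∀ j ∈ k.support, 1 ≤ |k j| := fun j hj =>
        Int.one_le_abs (Finsupp.mem_support_iff.1 hj)
      refine volume_sublevel_le (l := lam) (B := (H : ℝ) ^ R) hd0 hd1 (by positivity) ?_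
        (one_le_pow₀ hH1) R (Finsupp.support_nonempty_iff.2 hk0) ?_ ?_ n ?_
        (fun i _ j _ hij => hd i j hij) ?_
      · rw [div_le_one (by positivity)]; exact one_le_pow₀ hN1'
      · have : (k.support.card : ℤ) ≤ R := by
          refine le_trans ?_ hkR
          simpa using Finset.sum_le_sum hk1
        exact_mod_cast this
      · intro j hj
        exact_mod_cast hk1 j hj
      · intro j hj m hm
        obtain ⟨h1, h2⟩ := hQ N hN1 j (hkN j hj) m hm
        rw [← hH] at h1 h2
        exact ⟨lt_of_lt_of_le (by positivity) h1, fun q hq => rpow_le_of_abs_le hH1 h1 h2 hq⟩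
      · have h1 : A < d ^ R * N := by
          rw [div_lt_iff₀ (by positivity)] at hN₁
          have : (N₁ : ℝ) ≤ N := by exact_mod_cast hNN₁
          calc A < N₁ * d ^ R := hN₁
            _ ≤ N * d ^ R := by gcongr
            _ = _ := mul_comm _ _
        have h2 : 4 * (4 * ((H : ℝ) ^ R) ^ 2) ^ R * (H : ℝ) ^ R
            = A * (N : ℝ) ^ (2 * R * (2 * R + 1)) := by
          rw [hA, hH]; ring
        have h3 : (N : ℝ) ^ τ = (N : ℝ) ^ (2 * R * (2 * R + 1)) * ((N : ℝ) ^ (R + 4)) ^ R * N := by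
          rw [hτ]; ring
        rw [h2, h3, mul_pow, div_pow, one_pow]
        rw [show 1 / ((N : ℝ) ^ (2 * R * (2 * R + 1)) * ((N : ℝ) ^ (R + 4)) ^ R * N) *
          (A * (N : ℝ) ^ (2 * R * (2 * R + 1))) = A / N * (1 / ((N : ℝ) ^ (R + 4)) ^ R) by
          field_simp]
        gcongr
        rwa [div_lt_iff₀ hN0]
    calc volume (bad N) ≤ ∑ k ∈ P, ∑ n ∈ J, ENNReal.ofReal (2 ^ R * δ) := by
          refine (measure_mono hsub).trans ((measure_biUnion_finset_le _ _).trans ?_)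
          refine Finset.sum_le_sum fun k hk => (measure_biUnion_finset_le _ _).trans ?_
          exact Finset.sum_le_sum fun n hn => heach k hk n hn
      _ = ENNReal.ofReal (P.card * (J.card * (2 ^ R * δ))) := by
          simp only [Finset.sum_const, nsmul_eq_mul]
          rw [ENNReal.ofReal_mul (p := (P.card : ℝ)) (by positivity),
            ENNReal.ofReal_mul (p := (J.card : ℝ)) (by positivity), ENNReal.ofReal_natCast,
            ENNReal.ofReal_natCast]
      _ ≤ ENNReal.ofReal (c * (1 / (N : ℝ) ^ 2)) := by
          refine ENNReal.ofReal_le_ofReal ?_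
          have h1 : (P.card : ℝ) ≤ (3 * N) ^ R := by
            have : P.card ≤ (3 * s.card) ^ R :=
              (Finset.card_le_card (Finset.filter_subset _ K)).trans hKc
            rw [hscard] at this
            exact_mod_cast this
          have h2 : (J.card : ℝ) ≤ (2 * R * Q + 3) * (N : ℝ) ^ 2 := by
            rw [hJc]; push_cast; rw [hH]
            nlinarith [one_le_pow₀ hN1' (n := 2)]
          calc (P.card : ℝ) * (J.card * (2 ^ R * δ))
              ≤ (3 * N) ^ R * ((2 * R * Q + 3) * (N : ℝ) ^ 2 * (2 ^ R * δ)) := by gcongr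
            _ = c * (1 / (N : ℝ) ^ 2) := by
              simp only [c, δ]
              rw [show (6 : ℝ) = 3 * 2 by norm_num, mul_pow, mul_pow]
              field_simp
              ring
  have hsum : ∑' N, volume (bad N) ≠ ⊤ := by
    have h1 : Summable fun N : ℕ => c * (1 / (N : ℝ) ^ 2) :=
      (Real.summable_one_div_nat_pow.2 one_lt_two).mul_left c
    exact ne_top_of_le_ne_top h1.tsum_ofReal_ne_top (ENNReal.tsum_le_tsum hbad)
  refine ⟨τ, ?_⟩
  filter_upwards [ae_eventually_notMem hsum] with m hm hmI
  filter_upwards [hm, eventually_ge_atTop (max N₁ 1)] with N hN hNge k hk0 hkR hkN n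
  by_contra! h
  exact hN ⟨hmI, hNge, k, hk0, hkR, hkN, n, h⟩

/-! ### Elimination of the high modes -/

/-- Two distinct positive integers with coefficients `±1` cannot cancel. This covers vectors without
low modes, to which the small divisor bound does not apply. -/
lemma sum_mul_ne_zero_of_sum_abs_le_two {T : Finset ℕ+} (hT : T.Nonempty) {k : ℕ+ → ℤ}
    (hk : ∀ j ∈ T, k j ≠ 0) (hsum : ∑ j ∈ T, |k j| ≤ 2) : ∑ j ∈ T, (j : ℤ) * k j ≠ 0 := by
  have hcard : (T.card : ℤ) ≤ 2 := by
    refine le_trans ?_ hsum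
    simpa using Finset.sum_le_sum fun j hj => Int.one_le_abs (hk j hj)
  have hcard' : T.card = 1 ∨ T.card = 2 := by
    have := hT.card_pos
    omega
  rcases hcard' with h | h
  · obtain ⟨j, rfl⟩ := Finset.card_eq_one.1 h
    simpa using hk j (by simp)
  · obtain ⟨i, j, hij, rfl⟩ := Finset.card_eq_two.1 h
    rw [Finset.sum_pair hij] at hsum ⊢
    have hi := Int.one_le_abs (hk i (by simp))
    have hj := Int.one_le_abs (hk j (by simp))
    have hij' : ((i : ℕ) : ℤ) ≠ (j : ℕ) := by exact_mod_cast fun h => hij (PNat.eq h)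
    have hi0 : (0 : ℤ) < (i : ℕ) := by exact_mod_cast i.pos
    have hj0 : (0 : ℤ) < (j : ℕ) := by exact_mod_cast j.pos
    have hi1 : |k i| = 1 := by omega
    have hj1 : |k j| = 1 := by omega
    rcases (abs_eq zero_le_one).1 hi1 with h1 | h1 <;>
      rcases (abs_eq zero_le_one).1 hj1 with h2 | h2 <;> rw [h1, h2] <;> omega

/-- Frequencies asymptotic to the integers are nonresonant as soon as they satisfy a small
divisor estimate with an integer shift. -/
theorem nonResonant_of_small_divisor_bound {ω : ℕ+ → ℝ} {D : ℝ}
    (hω : ∀ j, |ω j - (j : ℝ)| ≤ D / j) (r τ : ℕ)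
    (h : ∀ᶠ N : ℕ in atTop, ∀ k : ℕ+ →₀ ℤ, k ≠ 0 →
      ∑ j ∈ k.support, |k j| ≤ ((r + 2 : ℕ) : ℤ) → (∀ j ∈ k.support, (j : ℕ) ≤ N) → ∀ n : ℤ,
        1 / (N : ℝ) ^ τ < |∑ j ∈ k.support, ω j * (k j : ℝ) + n|) :
    NonResonant r ω := by
  have hD : 0 ≤ D := by simpa using (abs_nonneg _).trans (hω 1)
  have hωD : ∀ j, |ω j - (j : ℝ)| ≤ D := fun j =>
    (hω j).trans (div_le_self hD (by exact_mod_cast (one_le : 1 ≤ j)))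
  set R : ℕ := r + 2 with hR
  -- Replacing `ω_j` by `j` for `j > N ^ p` costs at most `2 D / N ^ p`, which is below half of `1 /
  -- N ^ τ` once `N² ≥ 4 D`.
  set p : ℕ := τ + 2 with hp
  -- The exponent comes from the bound at scale `2 N ^ p`; the power of `2` also covers the bound `1
  -- / (2 N ^ τ)` of the other cases.
  refine ⟨1 / 2 ^ (τ + 1), by positivity, ((p * τ : ℕ) : ℝ), ?_⟩
  have htend : Tendsto (fun N : ℕ => 2 * N ^ p) atTop atTop :=
    tendsto_atTop_mono (fun N => by
      have := Nat.le_self_pow (n := p) (by omega) N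
      change N ≤ _
      omega) tendsto_id
  obtain ⟨M, hM⟩ := exists_nat_gt (max (4 * D) (2 * D + R + R * D + 1))
  filter_upwards [h, htend.eventually h, eventually_ge_atTop (max M 1)]
    with N hN hN2 hNM k hk0 hkR hkT
  have hkR' : ∑ j ∈ k.support, |k j| ≤ (R : ℤ) := by rw [hR]; push_cast; exact hkR
  have hN1 : 1 ≤ N := (le_max_right _ _).trans hNM
  have hN1' : (1 : ℝ) ≤ N := by exact_mod_cast hN1
  have hMN : (M : ℝ) ≤ N := by exact_mod_cast (le_max_left _ _).trans hNM
  have hM1 : 4 * D ≤ N := (le_max_left _ _).trans (hM.le.trans hMN)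
  have hM2 : 2 * D + R + R * D + 1 ≤ N := (le_max_right _ _).trans (hM.le.trans hMN)
  have hNp : N ^ 2 ≤ N ^ p := Nat.pow_le_pow_right hN1 (by omega)
  have hNp' : (N : ℝ) ^ 2 ≤ (N : ℝ) ^ p := by exact_mod_cast hNp
  have hNNp : N ≤ N ^ p := Nat.le_self_pow (by omega) N
  rw [Real.rpow_natCast]
  have hbig : ∀ x : ℝ, 1 / (2 * (N : ℝ) ^ τ) ≤ x → 1 / 2 ^ (τ + 1) / (N : ℝ) ^ (p * τ) ≤ x := by
    intro x hx
    refine le_trans ?_ hx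
    rw [div_div]
    refine one_div_le_one_div_of_le (by positivity) (mul_le_mul ?_ ?_ (by positivity) (by positivity))
    · exact le_self_pow₀ one_le_two (by omega)
    · exact pow_le_pow_right₀ hN1' (by nlinarith)
  have hτ1 : 1 / (2 * (N : ℝ) ^ τ) ≤ 1 := by
    rw [div_le_one (by positivity)]
    nlinarith [one_le_pow₀ hN1' (n := τ)]
  by_cases hA : ∀ j ∈ k.support, (j : ℕ) ≤ 2 * N ^ p
  · have := hN2 k hk0 hkR' hA 0
    rw [Int.cast_zero, add_zero] at this
    refine le_trans ?_ this.le
    push_cast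
    rw [div_div, mul_pow, ← pow_mul]
    refine one_div_le_one_div_of_le (by positivity) ?_
    gcongr
    · exact one_le_two
    · omega
  push Not at hA
  obtain ⟨J, hJk, hJ⟩ := hA
  set T := k.support.filter fun j : ℕ+ => N < (j : ℕ)
  set U := k.support.filter fun j : ℕ+ => ¬ N < (j : ℕ)
  have hJT : J ∈ T := Finset.mem_filter.2 ⟨hJk, by omega⟩
  have hkne : ∀ j ∈ T, k j ≠ 0 := fun j hj =>
    Finsupp.mem_support_iff.1 (Finset.mem_filter.1 hj).1
  have hUR : ∑ j ∈ U, |k j| ≤ (R : ℤ) :=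
    (Finset.sum_le_sum_of_subset_of_nonneg (Finset.filter_subset _ _)
      fun _ _ _ => abs_nonneg _).trans hkR'
  have hsplit : ∑ j ∈ k.support, ω j * (k j : ℝ)
      = ∑ j ∈ U, ω j * (k j : ℝ) + ∑ j ∈ T, ω j * (k j : ℝ) := by
    rw [add_comm]; exact (Finset.sum_filter_add_sum_filter_not _ _ _).symm
  apply hbig
  rw [hsplit]
  -- All high modes exceed `N ^ p`: they contribute an integer `n` up to a small error.
  by_cases hB : ∀ j ∈ T, N ^ p < (j : ℕ)
  · set n : ℤ := ∑ j ∈ T, (j : ℤ) * k j with hn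
    have hLn : 1 / (N : ℝ) ^ τ ≤ |∑ j ∈ U, ω j * (k j : ℝ) + n| := by
      rcases U.eq_empty_or_nonempty with hU | hU
      · rw [hU, Finset.sum_empty, zero_add]
        have h1 : (1 : ℝ) ≤ |(n : ℝ)| := by
          exact_mod_cast Int.one_le_abs (sum_mul_ne_zero_of_sum_abs_le_two ⟨J, hJT⟩ hkne hkT)
        refine le_trans ?_ h1
        rw [div_le_one (by positivity)]
        exact one_le_pow₀ hN1'
      · set k' := k.filter fun j : ℕ+ => ¬ N < (j : ℕ) with hk'
        have hsupp : k'.support = U := Finsupp.support_filter _ _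
        have hval : ∀ j ∈ U, k' j = k j := fun j hj =>
          Finsupp.filter_apply_pos _ _ (Finset.mem_filter.1 hj).2
        have h1 := hN k' (Finsupp.support_nonempty_iff.1 (hsupp ▸ hU))
          (by rw [hsupp, Finset.sum_congr rfl fun j hj => by rw [hval j hj]]; exact hUR)
          (fun j hj => by
            rw [hsupp] at hj
            exact not_lt.1 (Finset.mem_filter.1 hj).2) n
        rw [hsupp, Finset.sum_congr rfl fun j hj => by rw [hval j hj]] at h1
        exact h1.le
    have herr : |∑ j ∈ T, ω j * (k j : ℝ) - n| ≤ D / (N : ℝ) ^ p * 2 := by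
      have h1 : ∑ j ∈ T, ω j * (k j : ℝ) - n = ∑ j ∈ T, (ω j - (j : ℝ)) * (k j : ℝ) := by
        rw [hn]; push_cast
        rw [← Finset.sum_sub_distrib]
        exact Finset.sum_congr rfl fun j _ => by ring
      rw [h1]
      calc _ ≤ ∑ j ∈ T, |(ω j - (j : ℝ)) * (k j : ℝ)| := Finset.abs_sum_le_sum_abs _ _
        _ ≤ ∑ j ∈ T, D / (N : ℝ) ^ p * |(k j : ℝ)| := by
          refine Finset.sum_le_sum fun j hj => ?_
          rw [abs_mul]
          gcongr
          refine (hω j).trans ?_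
          gcongr
          exact_mod_cast (hB j hj).le
        _ = D / (N : ℝ) ^ p * ((∑ j ∈ T, |k j| : ℤ) : ℝ) := by
          rw [← Finset.mul_sum]; push_cast; rfl
        _ ≤ D / (N : ℝ) ^ p * ((2 : ℤ) : ℝ) := by gcongr
        _ = _ := by norm_num
    have herr' : D / (N : ℝ) ^ p * 2 ≤ 1 / (2 * (N : ℝ) ^ τ) := by
      have h4 : 4 * D ≤ (N : ℝ) ^ 2 := by nlinarith
      rw [hp, pow_add, div_mul_eq_mul_div, div_le_div_iff₀ (by positivity) (by positivity)]
      have : (0 : ℝ) < (N : ℝ) ^ τ := by positivity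
      nlinarith
    have hhalf : 1 / (N : ℝ) ^ τ = 2 * (1 / (2 * (N : ℝ) ^ τ)) := by field_simp
    have h5 := abs_sub_abs_le_abs_sub (∑ j ∈ U, ω j * (k j : ℝ) + n)
      (-(∑ j ∈ T, ω j * (k j : ℝ) - n))
    rw [abs_neg, show (∑ j ∈ U, ω j * (k j : ℝ) + n) - -(∑ j ∈ T, ω j * (k j : ℝ) - n)
      = ∑ j ∈ U, ω j * (k j : ℝ) + ∑ j ∈ T, ω j * (k j : ℝ) by ring] at h5
    linarith
  -- One high mode is at most `N ^ p` and the other exceeds `2 N ^ p`, both with coefficient `±1`;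
  -- the latter outweighs it and the `O(N)` low part.
  · push Not at hB
    obtain ⟨i, hiT, hi⟩ := hB
    have hiJ : i ≠ J := by rintro rfl; omega
    have hTeq : {i, J} = T := by
      refine Finset.eq_of_subset_of_card_le ?_ ?_
      · intro j hj
        rcases Finset.mem_insert.1 hj with rfl | hj
        · exact hiT
        · exact (Finset.mem_singleton.1 hj) ▸ hJT
      · rw [Finset.card_pair hiJ]
        have : (T.card : ℤ) ≤ 2 := by
          refine le_trans ?_ hkT
          simpa using Finset.sum_le_sum fun j hj => Int.one_le_abs (hkne j hj)
        exact_mod_cast this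
    have hki := Int.one_le_abs (hkne i hiT)
    have hkJ := Int.one_le_abs (hkne J hJT)
    rw [← hTeq, Finset.sum_pair hiJ] at hkT
    have hki1 : |(k i : ℝ)| = 1 := by
      have : |k i| = 1 := by omega
      exact_mod_cast this
    have hkJ1 : |(k J : ℝ)| = 1 := by
      have : |k J| = 1 := by omega
      exact_mod_cast this
    have hU : |∑ j ∈ U, ω j * (k j : ℝ)| ≤ (N + D) * R := by
      calc _ ≤ ∑ j ∈ U, |ω j * (k j : ℝ)| := Finset.abs_sum_le_sum_abs _ _
        _ ≤ ∑ j ∈ U, (N + D) * |(k j : ℝ)| := by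
          refine Finset.sum_le_sum fun j hj => ?_
          rw [abs_mul]
          gcongr
          have h1 : (j : ℝ) ≤ N := by exact_mod_cast not_lt.1 (Finset.mem_filter.1 hj).2
          have h2 := abs_le.1 (hωD j)
          have h3 : (0 : ℝ) ≤ (j : ℕ) := Nat.cast_nonneg _
          exact abs_le.2 ⟨by linarith, by linarith⟩
        _ = (N + D) * ((∑ j ∈ U, |k j| : ℤ) : ℝ) := by
          rw [← Finset.mul_sum]; push_cast; rfl
        _ ≤ (N + D) * ((R : ℤ) : ℝ) := by gcongr
        _ = _ := by norm_num
    have hωJ : 2 * (N : ℝ) ^ p - D ≤ |ω J * (k J : ℝ)| := by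
      rw [abs_mul, hkJ1, mul_one]
      have h1 : 2 * (N : ℝ) ^ p ≤ J := by exact_mod_cast hJ.le
      have h2 := abs_le.1 (hωD J)
      exact le_trans (by linarith) (le_abs_self _)
    have hωi : |ω i * (k i : ℝ)| ≤ (N : ℝ) ^ p + D := by
      rw [abs_mul, hki1, mul_one]
      have h1 : (i : ℝ) ≤ (N : ℝ) ^ p := by exact_mod_cast hi
      have h2 := abs_le.1 (hωD i)
      have h3 : (0 : ℝ) ≤ (i : ℕ) := Nat.cast_nonneg _
      exact abs_le.2 ⟨by linarith, by linarith⟩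
    rw [← hTeq, Finset.sum_pair hiJ]
    have h5 := abs_sub_abs_le_abs_sub (ω J * (k J : ℝ))
      (-(∑ j ∈ U, ω j * (k j : ℝ) + ω i * (k i : ℝ)))
    have h6 := abs_add_le (∑ j ∈ U, ω j * (k j : ℝ)) (ω i * (k i : ℝ))
    rw [abs_neg, show ω J * (k J : ℝ) - -(∑ j ∈ U, ω j * (k j : ℝ) + ω i * (k i : ℝ))
      = ∑ j ∈ U, ω j * (k j : ℝ) + (ω i * (k i : ℝ) + ω J * (k J : ℝ)) by ring] at h5
    have h7 : (N : ℝ) * (2 * D + R + R * D + 1) ≤ (N : ℝ) ^ p := by nlinarith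
    have h8 : 2 * D + 1 + R * D ≤ N * (2 * D + 1 + R * D) :=
      le_mul_of_one_le_left (by positivity) hN1'
    nlinarith

/-! ### Almost every mass is nonresonant -/

/-- The frequencies are asymptotic to the integers. -/
lemma abs_sqrt_sub_le {l C m : ℝ} {j : ℕ+} (hl : |l - (j : ℝ) ^ 2| ≤ C) (hm : 0 ≤ l + m) :
    |√(l + m) - (j : ℝ)| ≤ (C + |m|) / j := by
  have hj : (0 : ℝ) < (j : ℕ) := by exact_mod_cast j.pos
  rw [le_div_iff₀ hj]
  have h1 : (√(l + m) - (j : ℝ)) * (√(l + m) + j) = l - (j : ℝ) ^ 2 + m := by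
    linear_combination Real.sq_sqrt hm
  calc |√(l + m) - (j : ℝ)| * j ≤ |√(l + m) - (j : ℝ)| * |√(l + m) + j| := by
        gcongr
        exact le_trans (by linarith [Real.sqrt_nonneg (l + m)]) (le_abs_self _)
    _ = |l - (j : ℝ) ^ 2 + m| := by rw [← abs_mul, h1]
    _ ≤ C + |m| := (abs_add_le _ _).trans (by linarith)

/-- Almost every mass above the threshold gives nonresonant frequencies. -/
theorem ae_nonResonant {V : ℝ → ℝ} (hV : Continuous V) :
    ∀ᵐ m : ℝ, threshold V < m → ∀ r : ℕ, NonResonant r (frequency V m) := by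
  obtain ⟨lam, hmono, ⟨C, hC⟩, hspec⟩ := exists_spectrum hV
  have hfreq : ∀ m, frequency V m = fun j => √(lam j + m) := fun m =>
    funext fun j => by rw [frequency, eigenvalue_eq hmono hspec]
  rw [threshold_eq hmono hspec]
  -- Countably many compact intervals exhaust the half-line above the threshold; on each, `lam 1 +
  -- m` stays away from `0`.
  have hall : ∀ r n : ℕ, ∀ᵐ m : ℝ, m ∈ Icc (-lam 1 + 1 / (n + 1 : ℝ)) n →
      NonResonant r (frequency V m) := by
    intro r n
    have hn : (0 : ℝ) < 1 / (n + 1 : ℝ) := by positivity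
    obtain ⟨τ, hτ⟩ := ae_small_divisor_bound hmono hC (a := -lam 1 + 1 / (n + 1 : ℝ)) (b := n)
      (by linarith) (r + 2)
    filter_upwards [hτ] with m hm hmI
    rw [hfreq]
    refine nonResonant_of_small_divisor_bound (D := C + |m|)
      (fun j => abs_sqrt_sub_le (hC j) ?_) r τ (hm hmI)
    have : lam 1 ≤ lam j := hmono.monotone one_le
    linarith [hmI.1]
  filter_upwards [ae_all_iff.2 fun r => ae_all_iff.2 (hall r)] with m hm hlt r
  obtain ⟨n₁, hn₁⟩ := exists_nat_one_div_lt (show 0 < m + lam 1 by linarith)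
  obtain ⟨n₂, hn₂⟩ := exists_nat_ge m
  refine hm r (max n₁ n₂) ⟨?_, ?_⟩
  · have : 1 / ((max n₁ n₂ : ℕ) + 1 : ℝ) ≤ 1 / (n₁ + 1 : ℝ) := by
      gcongr
      exact le_max_left _ _
    linarith
  · exact hn₂.trans (by exact_mod_cast le_max_right _ _)

end DirichletNLW

theorem theorem3p15 (V₀ : ℝ → ℝ) (hsmooth : ContDiff ℝ (⊤ : ℕ∞) V₀)
    (hper : Function.Periodic V₀ (2 * Real.pi))
    (havg : ∫ x in (0 : ℝ)..(2 * Real.pi), V₀ x = 0)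
    (Δ : ℝ) (hΔ : DirichletNLW.threshold V₀ < Δ) :
    ∃ I : Set ℝ, I ⊆ Set.Ioo (DirichletNLW.threshold V₀) Δ ∧ MeasurableSet I ∧
      volume I = ENNReal.ofReal (Δ - DirichletNLW.threshold V₀) ∧
      ∀ m ∈ I, ∀ r : ℕ, 1 ≤ r → DirichletNLW.NonResonant r (DirichletNLW.frequency V₀ m) := by
  have hae := DirichletNLW.ae_nonResonant hsmooth.continuous
  rw [ae_iff] at hae
  -- A measurable null hull avoids having to show that the exceptional set itself is measurable.
  set B : Set ℝ := toMeasurable volume {m : ℝ | ¬(DirichletNLW.threshold V₀ < m →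
    ∀ r : ℕ, DirichletNLW.NonResonant r (DirichletNLW.frequency V₀ m))}
  have hB : volume B = 0 := (measure_toMeasurable _).trans hae
  refine ⟨Set.Ioo (DirichletNLW.threshold V₀) Δ \ B, Set.sdiff_subset,
    measurableSet_Ioo.diff (measurableSet_toMeasurable _ _), ?_, ?_⟩
  · rw [measure_sdiff_null hB, Real.volume_Ioo]
  · rintro m ⟨hm, hmB⟩ r -
    by_contra hr
    exact hmB (subset_toMeasurable _ _ fun h => hr (h hm.1 r))
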